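/- **Setting.** Let $d\ge 1$ and let $\mathscr T_1,\dots,\mathscr T_d$ be leafless, locally finite rooted directed trees, $\mathscr T_j=(V_j,\mathcal E_j)$, with root $\mathsf{root}_j$, such that the depths of the branching vertices (those with at least two children) of each $\mathscr T_j$ are bounded (finite joint branching index). Let $V=V_1\times\cdots\times V_d$ be the vertex set of their directed Cartesian product $\mathscr T$ and $\mathsf{root}=(\mathsf{root}_1,\dots,\mathsf{root}_d)$. For $v\in V$ let $\mathsf d_v=(\mathsf d_{v_1},\dots,\mathsf d_{v_d})\in\mathbb N^d$ be its depth and $|\mathsf d_v|=\sum_j\mathsf d_{v_j}$; $\mathsf{Chi}_j(v)$ is the set of vertices obtained from $v$ by replacing $v_j$ by one of its children, and $\mathsf{par}_j(v)$ (if $v_j\ne\mathsf{root}_j$) is obtained by replacing $v_j$ by its parent; $\mathsf{sib}(v_j)$ is the set of all children of the parent of $v_j$ (including $v_j$). Let $a\ge d$ be an integer and $\mathfrak c_a(t)=\frac{t+d}{t+a}$, $t\in\mathbb N$. The Drury–Arveson-type multishift $S=(S_1,\dots,S_d)$ is the commuting $d$-tuple of bounded operators on $\ell^2(V)$ given by $(S_jf)(v)=\lambda_j(v)f(\mathsf{par}_j(v))$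 if $v_j\ne\mathsf{root}_j$ and $(S_jf)(v)=0$ otherwise, where $$\lambda_j(w)=\sqrt{\frac{\mathfrak c_a(|\mathsf d_v|)}{\mathrm{card}(\mathsf{Chi}_j(v))}}\sqrt{\frac{\mathsf d_{v_j}+1}{|\mathsf d_v|+d}},\qquad w\in\mathsf{Chi}_j(v).$$ Let $E=\bigcap_j\ker S_j^*$. The analytic model $\mathscr H_{\mathfrak c_a}(\mathscr T)$ of $S$ is the space of $E$-valued functions $\sum_{\alpha\in\mathbb N^d}f_\alpha z^\alpha$ on the open unit ball of $\mathbb C^d$ with $f_\alpha\in E$ and $\sum_\alpha\|S^\alpha f_\alpha\|^2<\infty$, with inner product $\langle\sum f_\alpha z^\alpha,\sum g_\alpha z^\alpha\rangle=\sum_\alpha\langle S^\alpha f_\alpha,S^\alpha g_\alpha\rangle$. For $F\subseteq\{1,\dots,d\}$ let $\Phi_F$ be the set of $v\in V$ with $v_j\neq\mathsf{root}_j$ exactly for $j\in F$. For $u\in\Phi_F$ let $\mathsf{sib}_F(u)$ be the set of $w\in V$ with $w_j\in\mathsf{sib}(u_j)$ for $j\in F$ and $w_j=u_j$ for $j\notin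 F$. Let $\Omega_F\subseteq\Phi_F$ contain exactly one element of each of the classes $\mathsf{sib}_F(u)$, $u\in\Phi_F$. For $u\in\Omega_F$ let $\mathcal L_{u,F}$ be the space of $f\in\ell^2(V)$ that vanish off $\mathsf{sib}_F(u)$ and satisfy $\sum_{w}f(w)\lambda_j(w)=0$ for every $j\in F$ and $v\in\mathsf{sib}_F(u)$, the sum being over the $w\in \mathsf{sib}_F(u)$ with $w_i=v_i$ for all $i\ne j$. (Then $E=\bigoplus_F\bigoplus_{u\in\Omega_F}\mathcal L_{u,F}$.) A *representing measure* of $\mathscr H_{\mathfrak c_a}(\mathscr T)$, supported on $[0,b]\times\partial\mathbb B^d$ ($\partial\mathbb B^d$ the unit sphere of $\mathbb C^d$), is a $B(E)$-valued measure $M$ on $[0,b]\times\partial\mathbb B^d$ with scalar measures $\rho_u$ on $[0,b]$ and $\nu_u$ on $\partial\mathbb B^d$ ($u\in\Omega_F$, $F\subseteq\{1,\dots,d\}$) such that 1. $\|z^\alpha f\|^2_{\mathscr H_{\mathfrak c_a}(\mathscr T)}=\int s^{|\alpha|}|z^\alpha|^2\,\langle dM(s,z)f,f\rangle$ for all $f\in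 E$, $\alpha\in\mathbb N^d$; 2. $M(A)\big(\sum_{F,u}g_{u,F}\big)=\sum_{F,u}(\rho_u\times\nu_u)(A)\,g_{u,F}$ for all finite sums with $g_{u,F}\in\mathcal L_{u,F}$ and all Borel sets $A$; 3. $\rho_{\mathsf{root}}$ and $\nu_{\mathsf{root}}$ are probability measures. **Corollary 2.10.** If $a$ is an integer with $a\ge d$, then $\mathscr H_{\mathfrak c_a}(\mathscr T)$ admits a representing measure supported on $[0,1]\times\partial\mathbb B^d$ for which the finite positive measures $\rho_u$ and $\nu_u$, $u\in\Omega_F$, $F\subseteq\{1,\dots,d\}$, are given by $$d\rho_u(s)=\begin{cases}w_{|\mathsf d_u|}(s)\,dm(s)&\text{if }a>d,\\ d\delta_1(s)&\text{if }a=d,\end{cases}\qquad d\nu_u(z)=\frac{|z^{\mathsf d_u}|^2}{\|z^{\mathsf d_u}\|^2_{L^2(\partial\mathbb B^d,\sigma)}}\,d\sigma(z),$$ where $m$ is Lebesgue measure on $[0,1]$, $\delta_1$ is the unit point mass at $1$, $\sigma$ is the normalized surface area measure on $\partial\mathbb B^d$, and, for $a>d$, the function $$w_l(s)=(l+d)(l+d+1)\cdots(l+a-1)\sum_{i=d}^{a-1}\frac{s^{i+l-1}}{\prod_{d\le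 j\le a-1,\ j\ne i}(j-i)},\qquad s\in[0,1],\ l\in\mathbb N,$$ is nonnegative on $[0,1]$. -/

import Mathlib

open Set MeasureTheory
open scoped ENNReal lp InnerProductSpace

noncomputable section

/-- A rooted directed tree: a directed graph with a distinguished vertex `root` that has no parent,
in which every vertex has at most one parent and is reachable from the root by a directed path.
(There are then no circuits, and every vertex other than the root has exactly one parent.) -/
structure RootedDirectedTree (V : Type*) extends Digraph V where
  /-- the root -/
  root : V
  not_adj_root : ∀ v, ¬ Adj v root
  parent_unique : ∀ {u v w}, Adj u w → Adj v w → u = v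
  reachable : ∀ v, Relation.ReflTransGen Adj root v

namespace RootedDirectedTree

variable {V : Type*} (T : RootedDirectedTree V)

/-- The set `Chi(v)` of children of `v`. -/
def children (v : V) : Set V := {w | T.Adj v w}

open Classical in
/-- The parent of a vertex `w ≠ root` (by convention the root itself for `w = root`). -/
def parent (w : V) : V := if h : ∃ v, T.Adj v w then h.choose else T.root

/-- The set `sib(w) = Chi(par(w))` of siblings of `w ≠ root`, which contains `w`. -/
def sib (w : V) : Set V := T.children (T.parent w)

/-- `T.gen n` is `Chi^n(root)`, the `n`-th generation. -/
def gen : ℕ → Set V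
  | 0 => {T.root}
  | n + 1 => {w | ∃ v ∈ gen n, T.Adj v w}

/-- The depth of `v`: the (unique) `n` with `v ∈ Chi^n(root)`. -/
def depth (v : V) : ℕ := sInf {n | v ∈ T.gen n}

/-- Every vertex has finitely many children. -/
def LocallyFinite : Prop := ∀ v, (T.children v).Finite

/-- Every vertex has at least one child. -/
def Leafless : Prop := ∀ v, (T.children v).Nonempty

/-- The set of branching vertices, those with at least two children. -/
def branchingVertices : Set V := {v | 2 ≤ (T.children v).encard}

/-- The branching index: `1 + sup` of the depths of the branching vertices, and `0` if there is
no branching vertex; the value is `⊤` if these depths are unbounded. -/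
def branchingIndex : ℕ∞ := ⨆ w ∈ T.branchingVertices, (1 + (T.depth w : ℕ∞))

lemma children_of_parent {w : V} (hw : w ≠ T.root) : w ∈ T.children (T.parent w) := by
  have h : ∃ v, T.Adj v w := by
    rcases (Relation.ReflTransGen.cases_tail (T.reachable w)) with h | ⟨v, -, hv⟩
    · exact absurd h hw
    · exact ⟨v, hv⟩
  simp only [children, parent, dif_pos h, mem_ofPred_eq]
  exact h.choose_spec

end RootedDirectedTree

/-- Sequences `c : ℕ → (0, ∞)` with `inf c > 0` and `sup c < ∞`. -/
structure AdmissibleSeq where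
  /-- the sequence -/
  toFun : ℕ → ℝ
  inf_pos : ∃ ε > 0, ∀ t, ε ≤ toFun t
  bdd : ∃ C, ∀ t, toFun t ≤ C

/-- The sequence `c_a(t) = (t + d) / (t + a)`. -/
def druryArvesonSeq (d : ℕ) (a : ℝ) (hd : 0 < d) (ha : 0 < a) : AdmissibleSeq where
  toFun t := (t + d) / (t + a)
  inf_pos := by
    have hd' : (0 : ℝ) < d := by exact_mod_cast hd
    refine ⟨min 1 (d / a), by positivity, fun t => ?_⟩
    have ht : (0 : ℝ) ≤ t := t.cast_nonneg
    rw [le_div_iff₀ (by positivity)]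
    have h1 := mul_le_mul_of_nonneg_right (min_le_left 1 ((d : ℝ) / a)) ht
    have h2 := mul_le_mul_of_nonneg_right (min_le_right 1 ((d : ℝ) / a)) ha.le
    rw [div_mul_cancel₀ _ ha.ne'] at h2
    linarith
  bdd := by
    refine ⟨max 1 (d / a), fun t => ?_⟩
    have ht : (0 : ℝ) ≤ t := t.cast_nonneg
    rw [div_le_iff₀ (by positivity)]
    have h1 := mul_le_mul_of_nonneg_right (le_max_left 1 ((d : ℝ) / a)) ht
    have h2 := mul_le_mul_of_nonneg_right (le_max_right 1 ((d : ℝ) / a)) ha.le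
    rw [div_mul_cancel₀ _ ha.ne'] at h2
    linarith

namespace TreeProduct

variable {d : ℕ} {V : Fin d → Type*} (T : ∀ j, RootedDirectedTree (V j))

/-- The root of the directed Cartesian product, whose vertex set is `V 0 × ⋯ × V (d - 1)`. -/
def root : ∀ j, V j := fun j => (T j).root

/-- The depth multi-index `d_v` of a vertex `v` of the product. -/
def depth (v : ∀ j, V j) : Fin d → ℕ := fun j => (T j).depth (v j)

/-- The total depth `|d_v|`. -/
def absDepth (v : ∀ j, V j) : ℕ := ∑ j, depth T v j

/-- `par_j(v)`: the `j`-th coordinate is replaced by its parent. -/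
def par (j : Fin d) (v : ∀ j, V j) : ∀ j, V j := Function.update v j ((T j).parent (v j))

/-- The weight `λ_j(w)`, for `w ∈ Chi_j(v)`, that is, for `v = par_j(w)` and `w_j ≠ root_j`. (The
value for `w_j = root_j` is never used.) Here `card Chi_j(v) = card Chi(v_j)`. -/
def weight (c : AdmissibleSeq) (j : Fin d) (w : ∀ j, V j) : ℝ :=
  √(c.toFun (absDepth T (par T j w)) / (((T j).children (par T j w j)).ncard : ℝ)) *
    √((((T j).depth (par T j w j) : ℝ) + 1) / ((absDepth T (par T j w) : ℝ) + d))

open Classical in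
/-- The map `Λ_j` on all complex functions on the vertex set. -/
def shiftFun (c : AdmissibleSeq) (j : Fin d) (f : (∀ j, V j) → ℂ) (v : ∀ j, V j) : ℂ :=
  if v j = (T j).root then 0 else (weight T c j v : ℂ) * f (par T j v)

lemma weight_sq_le (c : AdmissibleSeq) {C : ℝ} (hC : ∀ t, c.toFun t ≤ C) (j : Fin d)
    (v : ∀ j, V j) :
    weight T c j v ^ 2 ≤ C / (((T j).children (par T j v j)).ncard : ℝ) := by
  obtain ⟨ε, hε, hε'⟩ := c.inf_pos
  have hc : 0 ≤ c.toFun (absDepth T (par T j v)) := hε.le.trans (hε' _)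
  have hd : (1 : ℝ) ≤ d := by exact_mod_cast (Nat.succ_le_of_lt (Fin.pos j))
  have hle : ((T j).depth (par T j v j) : ℝ) ≤ absDepth T (par T j v) := by
    exact_mod_cast Finset.single_le_sum (f := depth T (par T j v)) (fun _ _ => Nat.zero_le _)
      (Finset.mem_univ j)
  rw [weight, mul_pow, Real.sq_sqrt (by positivity), Real.sq_sqrt (by positivity)]
  have h1 : (((T j).depth (par T j v j) : ℝ) + 1) / ((absDepth T (par T j v) : ℝ) + d) ≤ 1 := by
    rw [div_le_one (by positivity)]
    linarith
  calc _ ≤ c.toFun (absDepth T (par T j v)) / (((T j).children (par T j v j)).ncard : ℝ) * 1 := by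
        gcongr
    _ ≤ _ := by
        rw [mul_one]
        gcongr
        exact hC _

lemma sum_shiftFun_le (c : AdmissibleSeq) {C : ℝ} (hC : ∀ t, c.toFun t ≤ C) (j : Fin d)
    (f : (∀ j, V j) → ℂ) (hf : Summable fun v => ‖f v‖ ^ 2) (s : Finset (∀ j, V j)) :
    ∑ v ∈ s, ‖shiftFun T c j f v‖ ^ 2 ≤ C * ∑' v, ‖f v‖ ^ 2 := by
  classical
  obtain ⟨ε, hε, hε'⟩ := c.inf_pos
  have hC0 : 0 ≤ C := hε.le.trans ((hε' 0).trans (hC 0))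
  have key : ∀ u ∈ s.image (par T j),
      ∑ v ∈ s with par T j v = u, ‖shiftFun T c j f v‖ ^ 2 ≤ C * ‖f u‖ ^ 2 := by
    intro u _
    set N : ℕ := ((T j).children (u j)).ncard with hN
    have hterm : ∀ v ∈ s.filter (fun v => par T j v = u), ‖shiftFun T c j f v‖ ^ 2 ≤
        if v j = (T j).root then 0 else C / N * ‖f u‖ ^ 2 := by
      intro v hv
      obtain ⟨-, rfl⟩ := Finset.mem_filter.1 hv
      unfold shiftFun
      split_ifs with h
      · simp
      · rw [norm_mul, mul_pow, Complex.norm_real, Real.norm_eq_abs, sq_abs]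
        gcongr
        exact weight_sq_le T c hC j v
    refine (Finset.sum_le_sum hterm).trans ?_
    rw [Finset.sum_ite, Finset.sum_const_zero, zero_add, Finset.sum_const, nsmul_eq_mul,
      Finset.filter_filter]
    set A := s.filter (fun v => par T j v = u ∧ ¬ v j = (T j).root) with hA
    by_cases hfin : ((T j).children (u j)).Finite
    · have hcard : A.card ≤ N := by
        rw [hN, Set.ncard_eq_toFinset_card _ hfin]
        refine Finset.card_le_card_of_injOn (fun v => v j) ?_ ?_
        · intro v hv
          obtain ⟨-, hu, hr⟩ := Finset.mem_filter.1 hv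
          have hu' : u j = (T j).parent (v j) := by rw [← hu]; simp [par]
          simpa [hu'] using (T j).children_of_parent hr
        · intro v hv w hw hvw
          obtain ⟨-, hu, -⟩ := Finset.mem_filter.1 hv
          obtain ⟨-, hu', -⟩ := Finset.mem_filter.1 hw
          funext i
          by_cases hi : i = j
          · subst hi; exact hvw
          · have := congrFun (hu.trans hu'.symm) i
            simpa [par, hi] using this
      have hcard' : (A.card : ℝ) ≤ N := by exact_mod_cast hcard
      rw [← mul_assoc]
      refine mul_le_mul_of_nonneg_right ?_ (by positivity)
      rcases Nat.eq_zero_or_pos N with h0 | h0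
      · simp [h0, hC0]
      · have : (0 : ℝ) < N := by exact_mod_cast h0
        calc (A.card : ℝ) * (C / N) ≤ N * (C / N) := by gcongr
          _ = C := by field_simp
    · have h0 : N = 0 := Set.Infinite.ncard hfin
      simp only [h0, Nat.cast_zero, div_zero, zero_mul, mul_zero]
      positivity
  rw [← Finset.sum_fiberwise_of_maps_to (g := par T j)
    (fun v hv => Finset.mem_image_of_mem (par T j) hv)]
  refine (Finset.sum_le_sum key).trans ?_
  rw [← Finset.mul_sum]
  gcongr
  exact hf.sum_le_tsum _ (fun _ _ => by positivity)

lemma summable_sq (f : ℓ²(∀ j, V j, ℂ)) : Summable fun v => ‖f v‖ ^ 2 := by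
  have := lp.memℓp f
  simpa using this.summable (by norm_num)

lemma shiftFun_memℓp (c : AdmissibleSeq) (j : Fin d) (f : ℓ²(∀ j, V j, ℂ)) :
    Memℓp (shiftFun T c j f) 2 := by
  obtain ⟨C, hC⟩ := c.bdd
  refine memℓp_gen ?_
  simpa using summable_of_sum_le (fun _ => by positivity)
    (sum_shiftFun_le T c hC j f (summable_sq f))

/-- The operator `S_j` of the multishift with weights `weight T c`, a bounded operator on the
space of square summable functions on the vertex set. -/
def shift (c : AdmissibleSeq) (j : Fin d) : ℓ²(∀ j, V j, ℂ) →L[ℂ] ℓ²(∀ j, V j, ℂ) :=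
  LinearMap.mkContinuousOfExistsBound
    { toFun := fun f => ⟨shiftFun T c j f, shiftFun_memℓp T c j f⟩
      map_add' := fun f g => by
        ext v
        change shiftFun T c j (fun w => f w + g w) v = shiftFun T c j f v + shiftFun T c j g v
        by_cases h : v j = (T j).root <;> simp [shiftFun, h, mul_add]
      map_smul' := fun a f => by
        ext v
        by_cases h : v j = (T j).root <;> simp [shiftFun, h, mul_left_comm] }
    (by
      obtain ⟨C, hC⟩ := c.bdd
      have hC0 : 0 ≤ C := by
        obtain ⟨ε, hε, hε'⟩ := c.inf_pos
        exact hε.le.trans ((hε' 0).trans (hC 0))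
      refine ⟨√C, fun f => ?_⟩
      have hp : 0 < (2 : ℝ≥0∞).toReal := by norm_num
      refine lp.norm_le_of_forall_sum_le hp (by positivity) fun s => ?_
      have h1 := sum_shiftFun_le T c hC j f (summable_sq f) s
      have h2 := lp.norm_rpow_eq_tsum hp f
      simp only [ENNReal.toReal_ofNat, Real.rpow_ofNat] at h2 ⊢
      rw [mul_pow, Real.sq_sqrt hC0, h2]
      exact h1)

/-- `S^α = S_1^{α_1} ⋯ S_d^{α_d}`. -/
def shiftPow (c : AdmissibleSeq) (α : Fin d → ℕ) : ℓ²(∀ j, V j, ℂ) →L[ℂ] ℓ²(∀ j, V j, ℂ) :=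
  (List.ofFn fun j => shift T c j ^ α j).prod

/-- The joint kernel `E` of the adjoints `S_1^*, …, S_d^*`. -/
def jointKernel (c : AdmissibleSeq) : Submodule ℂ (ℓ²(∀ j, V j, ℂ)) :=
  ⨅ j, (ContinuousLinearMap.adjoint (shift T c j)).ker

/-! ### The decomposition of the joint kernel -/

/-- `Φ_F`: the vertices `v` with `v_j ≠ root_j` exactly for `j ∈ F`. -/
def Phi (F : Finset (Fin d)) : Set (∀ j, V j) := {v | ∀ j, j ∈ F ↔ v j ≠ (T j).root}

/-- `sib_F(u)`: the vertices `w` with `w_j ∈ sib(u_j)` for `j ∈ F` and `w_j = u_j` for `j ∉ F`. -/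
def sib (F : Finset (Fin d)) (u : ∀ j, V j) : Set (∀ j, V j) :=
  {w | ∀ j, (j ∈ F → w j ∈ (T j).sib (u j)) ∧ (j ∉ F → w j = u j)}

/-- `v_G`: the coordinates outside `G` are replaced by the roots. -/
def trunc (G : Finset (Fin d)) (v : ∀ j, V j) : ∀ j, V j :=
  fun j => if j ∈ G then v j else (T j).root

/-- `Ω` picks exactly one vertex from each of the classes `sib_F(u)`, `u ∈ Φ_F`, for every `F`. -/
def IsIndexing (Ω : Finset (Fin d) → Set (∀ j, V j)) : Prop :=
  ∀ F, Ω F ⊆ Phi T F ∧ ∀ v ∈ Phi T F, ∃! u, u ∈ Ω F ∧ u ∈ sib T F v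

/-- `L_{u,F}`: the `f ∈ ℓ²` that vanish off `sib_F(u)` and satisfy
`∑_{w ∈ sib_j(v_G | u_j)} f(w) λ_j(w) = 0` for all `j ∈ F`, `G = F \ {j}` and `v ∈ sib_F(u)`. -/
def cokerPiece (c : AdmissibleSeq) (u : ∀ j, V j) (F : Finset (Fin d)) :
    Set (ℓ²(∀ j, V j, ℂ)) :=
  {f | (∀ w, w ∉ sib T F u → f w = 0) ∧
    ∀ j ∈ F, ∀ v ∈ sib T F u,
      ∑ᶠ w ∈ sib T {j} (Function.update (trunc T (F.erase j) v) j (u j)),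
        f w * (weight T c j w : ℂ) = 0}

/-! ### The analytic model -/

/-- The monomial `z^α`. -/
def monom (z : EuclideanSpace ℂ (Fin d)) (α : Fin d → ℕ) : ℂ := ∏ j, z j ^ α j

/-- `f` is a family of power series coefficients of an element `G` of the model space. -/
def IsCoeff (c : AdmissibleSeq) {r : ℝ}
    (G : Metric.ball (0 : EuclideanSpace ℂ (Fin d)) r → jointKernel T c)
    (f : (Fin d → ℕ) → jointKernel T c) : Prop :=
  (Summable fun α => ‖shiftPow T c α (f α)‖ ^ 2) ∧
    ∀ z, HasSum (fun α => monom z.1 α • f α) (G z)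

/-- The analytic model `H_c(T)` on the ball of radius `r`: the space of the `E`-valued functions
`∑_α f_α z^α` on that ball with `f_α ∈ E` and `∑_α ‖S^α f_α‖² < ∞`. -/
def modelSpace (c : AdmissibleSeq) (r : ℝ) :
    Submodule ℂ (Metric.ball (0 : EuclideanSpace ℂ (Fin d)) r → jointKernel T c) where
  carrier := {G | ∃ f, IsCoeff T c G f}
  zero_mem' := ⟨0, by simp [summable_zero], fun z => by simp⟩
  add_mem' := by
    rintro G H ⟨f, hf, hf'⟩ ⟨g, hg, hg'⟩
    refine ⟨f + g, ?_, fun z => by simpa using (hf' z).add (hg' z)⟩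
    refine Summable.of_nonneg_of_le (fun _ => by positivity) (fun α => ?_)
      ((hf.add hg).mul_left 2)
    simp only [Pi.add_apply, Submodule.coe_add, map_add]
    have h1 := norm_add_le (shiftPow T c α (f α)) (shiftPow T c α (g α))
    have h2 := norm_nonneg (shiftPow T c α (f α) + shiftPow T c α (g α))
    nlinarith [sq_nonneg (‖shiftPow T c α (f α)‖ - ‖shiftPow T c α (g α)‖)]
  smul_mem' := by
    rintro a G ⟨f, hf, hf'⟩
    refine ⟨a • f, ?_, fun z => ?_⟩
    · simpa [norm_smul, mul_pow] using hf.mul_left (‖a‖ ^ 2)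
    · simpa [smul_comm a] using (hf' z).const_smul a

/-- The coefficients `f_α` of an element `∑_α f_α z^α` of the model space (for `r > 0` they are
determined by the function). -/
def coeff {c : AdmissibleSeq} {r : ℝ} (G : modelSpace T c r) : (Fin d → ℕ) → jointKernel T c :=
  G.2.choose

/-- The inner product `⟨F, G⟩ = ∑_α ⟨S^α f_α, S^α g_α⟩` of the model space (with Mathlib's
convention: conjugate linear in the first argument). -/
def modelInner {c : AdmissibleSeq} {r : ℝ} (F G : modelSpace T c r) : ℂ :=
  ∑' α, ⟪shiftPow T c α (coeff T F α : ℓ²(∀ j, V j, ℂ)), shiftPow T c α (coeff T G α)⟫_ℂ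

/-- The norm of the model space. -/
def modelNorm {c : AdmissibleSeq} {r : ℝ} (F : modelSpace T c r) : ℝ :=
  √(RCLike.re (modelInner T F F))

/-- The function `z ↦ z^α f`, for `f ∈ E`, as an element of the model space. -/
def monomial (c : AdmissibleSeq) (r : ℝ) (α : Fin d → ℕ) (f : jointKernel T c) :
    modelSpace T c r :=
  ⟨fun z => monom z.1 α • f, by
    classical
    refine ⟨Pi.single α f, ?_, fun z => ?_⟩
    · refine summable_of_ne_finset_zero (s := {α}) fun β hβ => ?_
      rw [Finset.mem_singleton] at hβ
      simp [Pi.single_eq_of_ne hβ]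
    · have := hasSum_single (f := fun β => monom z.1 β • (Pi.single α f : _ → jointKernel T c) β) α
        (fun β hβ => by simp [Pi.single_eq_of_ne hβ])
      simpa using this⟩

/-! ### Representing measures -/

/-- The unit sphere of `ℂ^d`. -/
abbrev Sphere (d : ℕ) : Type := Metric.sphere (0 : EuclideanSpace ℂ (Fin d)) 1

/-- The normalized surface area measure on the unit sphere of `ℂ^d`. -/
def sphereMeasure (d : ℕ) : Measure (Sphere d) :=
  let μ : Measure (Sphere d) := (volume : Measure (EuclideanSpace ℂ (Fin d))).toSphere
  (μ univ)⁻¹ • μ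

/-- `M` is a `B(E)`-valued product measure `(ρ_u × ν_u)`, `u ∈ Ω_F`, supported on `[0, b] × ∂𝔹`,
that represents the norms `‖z^α f‖`, `f ∈ E`, in the analytic model on the ball of radius `r`. -/
structure IsRepresentingMeasure (c : AdmissibleSeq) (r b : ℝ)
    (Ω : Finset (Fin d) → Set (∀ j, V j))
    (M : VectorMeasure (ℝ × Sphere d) (jointKernel T c →L[ℂ] jointKernel T c))
    (ρ : (∀ j, V j) → Measure ℝ) (ν : (∀ j, V j) → Measure (Sphere d)) : Prop where
  finite : ∀ F, ∀ u ∈ Ω F, IsFiniteMeasure (ρ u) ∧ IsFiniteMeasure (ν u)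
  supported_scalar : ∀ F, ∀ u ∈ Ω F, ρ u (Icc 0 b)ᶜ = 0
  supported : ∀ A, MeasurableSet A → Disjoint A (Icc 0 b ×ˢ univ) → M A = 0
  /-- For each `f ∈ E` the scalar set function `A ↦ ⟨M(A) f, f⟩` is a finite positive measure `μ`,
  and `‖z^α f‖²` is the integral of `s^|α| |z^α|²` against it. -/
  integral_representation : ∀ f : jointKernel T c, ∃ μ : Measure (ℝ × Sphere d),
    IsFiniteMeasure μ ∧
    (∀ A, MeasurableSet A → ⟪f, M A f⟫_ℂ = (μ.real A : ℂ)) ∧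
    ∀ α : Fin d → ℕ,
      Integrable (fun p => p.1 ^ (∑ j, α j) * ‖monom p.2.1 α‖ ^ 2) μ ∧
      modelNorm T (monomial T c r α f) ^ 2 =
        ∫ p, p.1 ^ (∑ j, α j) * ‖monom p.2.1 α‖ ^ 2 ∂μ
  /-- `M(A)` maps `∑ g_{u,F}` to `∑ (ρ_u × ν_u)(A) g_{u,F}`. -/
  diagonal : ∀ A, MeasurableSet A → ∀ I : Finset (Finset (Fin d) × (∀ j, V j)),
    (∀ p ∈ I, p.2 ∈ Ω p.1) → ∀ g : Finset (Fin d) × (∀ j, V j) → jointKernel T c,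
    (∀ p ∈ I, (g p : ℓ²(∀ j, V j, ℂ)) ∈ cokerPiece T c p.2 p.1) →
    M A (∑ p ∈ I, g p) = ∑ p ∈ I, ((((ρ p.2).prod (ν p.2)).real A : ℝ) : ℂ) • g p
  normalized : IsProbabilityMeasure (ρ (root T)) ∧ IsProbabilityMeasure (ν (root T))

/-- The weight function
`w_l(s) = (l + d) ⋯ (l + a - 1) ∑_{i = d}^{a - 1} s^{i + l - 1} / ∏_{d ≤ j ≤ a - 1, j ≠ i} (j - i)`. -/
def radialWeight (d a l : ℕ) (s : ℝ) : ℝ :=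
  (∏ k ∈ Finset.Ico d a, ((l : ℝ) + k)) *
    ∑ i ∈ Finset.Ico d a, s ^ (i + l - 1) / ∏ j ∈ (Finset.Ico d a).erase i, ((j : ℝ) - i)

end TreeProduct

end

/-! The shifts raise depth, and on the functions supported in depth `δ` the operator `S^α`
multiplies the squared norm by `G (δ + α) / G δ`, where `G β` is the squared norm of `z^β` in the
classical space on the ball, in which every tree is an infinite path. Depth therefore splits the
joint kernel `E` into mutually orthogonal pieces, finitely many since the branching indices are
finite, and it suffices to write `G (δ + α) / G δ` as the moment of `s^|α| |z^α|²` against a product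
measure `ρ × ν` depending on `δ` only. In polar coordinates the moments of `σ` reduce to Gaussian
integrals, which gives `ν`. Summing the partial fractions, the density of `ρ` is a multiple of
`s^(|δ| + d - 1) (1 - s)^(a - d - 1)`, so it is nonnegative and its moments are beta integrals. -/

noncomputable section

namespace RootedDirectedTree

variable {V : Type*} (T : RootedDirectedTree V)

lemma eq_of_mem_gen_of_mem_gen {n m : ℕ} {v : V} (hn : v ∈ T.gen n) (hm : v ∈ T.gen m) :
    n = m := by
  induction n generalizing m v with
  | zero =>
    obtain rfl : v = T.root := hn
    cases m with
    | zero => rfl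
    | succ m =>
      obtain ⟨u, -, hu⟩ := hm
      exact absurd hu (T.not_adj_root u)
  | succ n ih =>
    obtain ⟨u, hu, huv⟩ := hn
    cases m with
    | zero =>
      obtain rfl : v = T.root := hm
      exact absurd huv (T.not_adj_root u)
    | succ m =>
      obtain ⟨u', hu', huv'⟩ := hm
      obtain rfl := T.parent_unique huv huv'
      rw [ih hu hu']

lemma depth_eq_of_mem_gen {n : ℕ} {v : V} (hn : v ∈ T.gen n) : T.depth v = n :=
  T.eq_of_mem_gen_of_mem_gen (Nat.sInf_mem (s := {n | v ∈ T.gen n}) ⟨n, hn⟩) hn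

lemma mem_gen_depth (v : V) : v ∈ T.gen (T.depth v) := by
  refine Nat.sInf_mem (s := {n | v ∈ T.gen n}) ?_
  induction T.reachable v with
  | refl => exact ⟨0, rfl⟩
  | tail _ h ih =>
    obtain ⟨n, hn⟩ := ih
    exact ⟨n + 1, _, hn, h⟩

lemma depth_root : T.depth T.root = 0 := T.depth_eq_of_mem_gen rfl

variable {T}

lemma depth_of_mem_children {u v : V} (h : v ∈ T.children u) : T.depth v = T.depth u + 1 :=
  T.depth_eq_of_mem_gen ⟨u, T.mem_gen_depth u, h⟩

lemma parent_of_mem_children {u v : V} (h : v ∈ T.children u) : T.parent v = u := by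
  have h' : ∃ u, T.Adj u v := ⟨u, h⟩
  rw [parent, dif_pos h']
  exact T.parent_unique h'.choose_spec h

lemma ne_root_of_mem_children {u v : V} (h : v ∈ T.children u) : v ≠ T.root := by
  rintro rfl
  exact T.not_adj_root u h

lemma depth_of_mem_sib {u v : V} (hu : u ≠ T.root) (h : v ∈ T.sib u) :
    T.depth v = T.depth u := by
  rw [depth_of_mem_children h, depth_of_mem_children (T.children_of_parent hu)]

lemma depth_lt_toNat_branchingIndex (h : T.branchingIndex ≠ ⊤) {v : V}
    (hv : v ∈ T.branchingVertices) : T.depth v < T.branchingIndex.toNat := by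
  have hle : ((1 + T.depth v : ℕ) : ℕ∞) ≤ T.branchingIndex := by
    exact_mod_cast le_iSup₂ (f := fun w (_ : w ∈ T.branchingVertices) => 1 + (T.depth w : ℕ∞)) v hv
  have := ENat.toNat_le_toNat hle h
  rw [ENat.toNat_natCast] at this
  omega

lemma children_parent_eq_singleton (h : T.branchingIndex ≠ ⊤) {v : V}
    (hv : T.branchingIndex.toNat < T.depth v) : T.children (T.parent v) = {v} := by
  have hroot : v ≠ T.root := by
    rintro rfl
    simp [T.depth_root] at hv
  have hmem := T.children_of_parent hroot
  have hnot : T.parent v ∉ T.branchingVertices := fun hbr => by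
    have := depth_lt_toNat_branchingIndex h hbr
    rw [depth_of_mem_children hmem] at hv
    omega
  have hsub : (T.children (T.parent v)).Subsingleton := by
    rw [← Set.encard_le_one_iff_subsingleton]
    by_contra! hlt
    exact hnot (Order.add_one_le_of_lt hlt)
  exact hsub.eq_singleton_of_mem hmem

end RootedDirectedTree

lemma AdmissibleSeq.toFun_pos (c : AdmissibleSeq) (t : ℕ) : 0 < c.toFun t := by
  obtain ⟨ε, hε, hle⟩ := c.inf_pos
  exact hε.trans_le (hle t)

lemma hasSum_l2_norm_sq {ι : Type*} (f : ℓ²(ι, ℂ)) : HasSum (fun i => ‖f i‖ ^ 2) (‖f‖ ^ 2) := by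
  simpa using lp.hasSum_norm (p := 2) (by norm_num) f

namespace TreeProduct

variable {d : ℕ} {V : Fin d → Type*} {T : ∀ j, RootedDirectedTree (V j)}

/-! ### The shifts and the depth grading -/

lemma depth_root : depth T (root T) = 0 := funext fun j => (T j).depth_root

lemma depth_of_mem_sib {F : Finset (Fin d)} {u w : ∀ j, V j} (hu : u ∈ Phi T F)
    (hw : w ∈ sib T F u) : depth T w = depth T u := by
  funext j
  by_cases hj : j ∈ F
  · exact RootedDirectedTree.depth_of_mem_sib ((hu j).1 hj) ((hw j).1 hj)
  · simp only [depth, (hw j).2 hj]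

lemma mem_children_par {j : Fin d} {v : ∀ j, V j} (hv : v j ≠ (T j).root) :
    v j ∈ (T j).children (par T j v j) := by
  simpa [par] using (T j).children_of_parent hv

lemma update_par (j : Fin d) (v : ∀ j, V j) : Function.update (par T j v) j (v j) = v := by
  simp [par]

lemma par_update {u : ∀ j, V j} {j : Fin d} {x : V j} (hx : x ∈ (T j).children (u j)) :
    par T j (Function.update u j x) = u := by
  simp [par, RootedDirectedTree.parent_of_mem_children hx]

lemma depth_eq_depth_par_add_single {j : Fin d} {v : ∀ j, V j} (hv : v j ≠ (T j).root) :
    depth T v = depth T (par T j v) + Pi.single j 1 := by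
  funext i
  by_cases hi : i = j
  · subst hi
    simpa [depth] using RootedDirectedTree.depth_of_mem_children (mem_children_par hv)
  · simp [depth, par, hi]

lemma weight_sq (c : AdmissibleSeq) (j : Fin d) (v : ∀ j, V j) :
    weight T c j v ^ 2 =
      c.toFun (absDepth T (par T j v)) / ((T j).children (par T j v j)).ncard *
        ((depth T (par T j v) j + 1) / (absDepth T (par T j v) + d)) := by
  have hc : 0 ≤ c.toFun (absDepth T (par T j v)) := (c.toFun_pos _).le
  rw [weight, mul_pow, Real.sq_sqrt (by positivity), Real.sq_sqrt (by positivity), depth]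

lemma weight_ne_zero (c : AdmissibleSeq) {j : Fin d} {v : ∀ j, V j}
    (hv : ((T j).children (par T j v j)).ncard ≠ 0) : weight T c j v ≠ 0 := by
  have hc : 0 < c.toFun (absDepth T (par T j v)) := c.toFun_pos _
  have hd : (0 : ℝ) < d := by exact_mod_cast Fin.pos j
  have hcard : (0 : ℝ) < ((T j).children (par T j v j)).ncard := by
    exact_mod_cast Nat.pos_of_ne_zero hv
  rw [← pow_ne_zero_iff two_ne_zero, weight_sq]
  positivity

lemma shift_apply_of_eq_root (c : AdmissibleSeq) {j : Fin d} (f : ℓ²(∀ j, V j, ℂ))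
    {v : ∀ j, V j} (hv : v j = (T j).root) : shift T c j f v = 0 :=
  if_pos hv

lemma shift_apply_of_ne_root (c : AdmissibleSeq) {j : Fin d} (f : ℓ²(∀ j, V j, ℂ))
    {v : ∀ j, V j} (hv : v j ≠ (T j).root) :
    shift T c j f v = weight T c j v * f (par T j v) :=
  if_neg hv

lemma hasSum_children_norm_shift_sq (hfin : ∀ j, (T j).LocallyFinite) (hleaf : ∀ j, (T j).Leafless)
    (c : AdmissibleSeq) (j : Fin d) (f : ℓ²(∀ j, V j, ℂ)) (u : ∀ j, V j) :
    HasSum (fun x : (T j).children (u j) => ‖shift T c j f (Function.update u j x)‖ ^ 2)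
      (c.toFun (absDepth T u) * ((depth T u j + 1) / (absDepth T u + d)) * ‖f u‖ ^ 2) := by
  have : Fintype ((T j).children (u j)) := (hfin j (u j)).fintype
  have hcard : ((T j).children (u j)).ncard ≠ 0 := (hleaf j (u j)).ncard_pos (hfin j (u j)) |>.ne'
  have hterm (x : (T j).children (u j)) : ‖shift T c j f (Function.update u j x)‖ ^ 2 =
      c.toFun (absDepth T u) / ((T j).children (u j)).ncard *
        ((depth T u j + 1) / (absDepth T u + d)) * ‖f u‖ ^ 2 := by
    rw [shift_apply_of_ne_root c f
        (by simpa using RootedDirectedTree.ne_root_of_mem_children x.2), norm_mul, mul_pow,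
      Complex.norm_real, Real.norm_eq_abs, sq_abs, weight_sq, par_update x.2]
  have hsum := hasSum_fintype fun x : (T j).children (u j) =>
    ‖shift T c j f (Function.update u j x)‖ ^ 2
  simp only [hterm, Finset.sum_const, Finset.card_univ, nsmul_eq_mul, ← Nat.card_eq_fintype_card,
    Nat.card_coe_set_eq] at hsum ⊢
  convert hsum using 1
  field_simp

lemma hasSum_norm_shift_sq (hfin : ∀ j, (T j).LocallyFinite) (hleaf : ∀ j, (T j).Leafless)
    (c : AdmissibleSeq) (j : Fin d) (f : ℓ²(∀ j, V j, ℂ)) :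
    HasSum (fun u => c.toFun (absDepth T u) * ((depth T u j + 1) / (absDepth T u + d)) *
      ‖f u‖ ^ 2) (‖shift T c j f‖ ^ 2) := by
  let child (p : Σ u : ∀ j, V j, (T j).children (u j)) : ∀ j, V j := Function.update p.1 j p.2
  have hinj : Function.Injective child := by
    rintro ⟨u, x, hx⟩ ⟨u', x', hx'⟩ h
    obtain rfl : u = u' := by
      rw [← par_update hx, ← par_update hx']
      exact congrArg (par T j) h
    obtain rfl := Function.update_injective u j h
    rfl
  have hzero (v : ∀ j, V j) (hv : v ∉ range child) : ‖shift T c j f v‖ ^ 2 = 0 := by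
    have hroot : v j = (T j).root := by
      by_contra hne
      exact hv ⟨⟨par T j v, v j, mem_children_par hne⟩, update_par j v⟩
    simp [shift_apply_of_eq_root c f hroot]
  exact ((hinj.hasSum_iff hzero).2 (hasSum_l2_norm_sq _)).sigma
    (hasSum_children_norm_shift_sq hfin hleaf c j f)

end TreeProduct

/-- The operator `f ↦ 1_s f` on `ℓ²(ι)`. -/
def l2Indicator {ι : Type*} (s : Set ι) : ℓ²(ι, ℂ) →L[ℂ] ℓ²(ι, ℂ) :=
  LinearMap.mkContinuous
    { toFun := fun f => ⟨s.indicator f, (lp.memℓp f).mono' fun _ => norm_indicator_le_norm_self _ _⟩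
      map_add' := fun f g => Subtype.ext (indicator_add' s f g)
      map_smul' := fun a f => Subtype.ext (indicator_const_smul s a f) }
    1 fun f => by
      rw [one_mul]
      exact lp.norm_mono two_ne_zero fun _ => norm_indicator_le_norm_self _ _

lemma coe_l2Indicator {ι : Type*} (s : Set ι) (f : ℓ²(ι, ℂ)) :
    ⇑(l2Indicator s f) = s.indicator f := rfl

lemma inner_l2Indicator_left {ι : Type*} (s : Set ι) (f g : ℓ²(ι, ℂ)) :
    ⟪l2Indicator s f, g⟫_ℂ = ⟪f, l2Indicator s g⟫_ℂ := by
  classical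
  rw [lp.inner_eq_tsum, lp.inner_eq_tsum]
  refine tsum_congr fun i => ?_
  rw [coe_l2Indicator, coe_l2Indicator, indicator_apply, indicator_apply]
  split_ifs <;> simp

lemma inner_l2Indicator_self {ι : Type*} (s : Set ι) (f : ℓ²(ι, ℂ)) :
    ⟪f, l2Indicator s f⟫_ℂ = ((‖l2Indicator s f‖ ^ 2 : ℝ) : ℂ) := by
  have hidem : l2Indicator s (l2Indicator s f) = l2Indicator s f :=
    lp.ext (by simp only [coe_l2Indicator, indicator_indicator, inter_self])
  rw [← hidem, ← inner_l2Indicator_left, inner_self_eq_norm_sq_to_K, hidem]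
  norm_cast

namespace TreeProduct

variable {d : ℕ} {V : Fin d → Type*} {T : ∀ j, RootedDirectedTree (V j)}

variable (T) in
/-- The subspace of the functions that vanish off the vertices of depth `δ`. -/
def depthSpace (δ : Fin d → ℕ) : Submodule ℂ (ℓ²(∀ j, V j, ℂ)) where
  carrier := {f | ∀ v, depth T v ≠ δ → f v = 0}
  zero_mem' _ _ := rfl
  add_mem' {f g} hf hg v hv := by
    rw [lp.coeFn_add, Pi.add_apply, hf v hv, hg v hv, add_zero]
  smul_mem' a f hf v hv := by
    rw [lp.coeFn_smul, Pi.smul_apply, hf v hv, smul_zero]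

variable (T) in
lemma orthogonalFamily_depthSpace :
    OrthogonalFamily ℂ (fun δ => depthSpace T δ) fun δ => (depthSpace T δ).subtypeₗᵢ := by
  intro δ ε hδε f g
  change ⟪(f : ℓ²(∀ j, V j, ℂ)), (g : ℓ²(∀ j, V j, ℂ))⟫_ℂ = 0
  rw [lp.inner_eq_tsum]
  refine (tsum_congr fun v => ?_).trans tsum_zero
  by_cases hv : depth T v = δ
  · rw [g.2 v (hv ▸ hδε), inner_zero_right]
  · rw [f.2 v hv, inner_zero_left]

lemma mem_depthSpace_of_mem_cokerPiece {c : AdmissibleSeq} {F : Finset (Fin d)} {u : ∀ j, V j}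
    (hu : u ∈ Phi T F) {f : ℓ²(∀ j, V j, ℂ)} (hf : f ∈ cokerPiece T c u F) :
    f ∈ depthSpace T (depth T u) :=
  fun v hv => hf.1 v fun h => hv (depth_of_mem_sib hu h)

lemma shift_mem_depthSpace (c : AdmissibleSeq) (j : Fin d) {δ : Fin d → ℕ}
    {f : ℓ²(∀ j, V j, ℂ)} (hf : f ∈ depthSpace T δ) :
    shift T c j f ∈ depthSpace T (δ + Pi.single j 1) := by
  intro v hv
  by_cases hroot : v j = (T j).root
  · exact shift_apply_of_eq_root c f hroot
  · rw [depth_eq_depth_par_add_single hroot, ne_eq, add_left_inj] at hv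
    rw [shift_apply_of_ne_root c f hroot, hf _ hv, mul_zero]

lemma norm_shift_sq_of_mem_depthSpace (hfin : ∀ j, (T j).LocallyFinite)
    (hleaf : ∀ j, (T j).Leafless) (c : AdmissibleSeq) (j : Fin d) {δ : Fin d → ℕ}
    {f : ℓ²(∀ j, V j, ℂ)} (hf : f ∈ depthSpace T δ) :
    ‖shift T c j f‖ ^ 2 =
      c.toFun (∑ i, δ i) * ((δ j + 1) / ((∑ i, δ i : ℕ) + d)) * ‖f‖ ^ 2 := by
  refine (hasSum_norm_shift_sq hfin hleaf c j f).unique ?_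
  refine ((hasSum_l2_norm_sq f).mul_left _).congr_fun fun u => ?_
  by_cases hu : depth T u = δ
  · rw [absDepth, hu]
  · simp [hf u hu]

variable (T) in
/-- `A` maps functions supported in depth `δ` to functions supported in depth `δ + β`, multiplying
their squared norm by `G (δ + β) / G δ`. -/
def RaisesDepth (G : (Fin d → ℕ) → ℝ) (β : Fin d → ℕ)
    (A : ℓ²(∀ j, V j, ℂ) →L[ℂ] ℓ²(∀ j, V j, ℂ)) : Prop :=
  ∀ δ, ∀ f ∈ depthSpace T δ,
    A f ∈ depthSpace T (δ + β) ∧ ‖A f‖ ^ 2 = G (δ + β) / G δ * ‖f‖ ^ 2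

namespace RaisesDepth

variable {G : (Fin d → ℕ) → ℝ} {β γ : Fin d → ℕ} {A B : ℓ²(∀ j, V j, ℂ) →L[ℂ] ℓ²(∀ j, V j, ℂ)}

lemma one (hG : ∀ δ, G δ ≠ 0) : RaisesDepth T G 0 1 := by
  intro δ f hf
  simpa [hG δ] using hf

lemma mul (hG : ∀ δ, G δ ≠ 0) (hA : RaisesDepth T G β A) (hB : RaisesDepth T G γ B) :
    RaisesDepth T G (β + γ) (A * B) := by
  intro δ f hf
  obtain ⟨hBmem, hBnorm⟩ := hB δ f hf
  obtain ⟨hAmem, hAnorm⟩ := hA _ _ hBmem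
  rw [show δ + (β + γ) = δ + γ + β by abel, mul_apply_eq_comp, hAnorm, hBnorm, ← mul_assoc,
    div_mul_div_cancel₀ (hG (δ + γ))]
  exact ⟨hAmem, rfl⟩

lemma pow (hG : ∀ δ, G δ ≠ 0) (hA : RaisesDepth T G β A) (n : ℕ) :
    RaisesDepth T G (n • β) (A ^ n) := by
  induction n with
  | zero => simpa using one hG
  | succ n ih =>
    rw [pow_succ, succ_nsmul]
    exact ih.mul hG hA

lemma list_prod {ι : Type*} (hG : ∀ δ, G δ ≠ 0) {β : ι → Fin d → ℕ}
    {A : ι → ℓ²(∀ j, V j, ℂ) →L[ℂ] ℓ²(∀ j, V j, ℂ)} (hA : ∀ i, RaisesDepth T G (β i) (A i))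
    (l : List ι) : RaisesDepth T G (l.map β).sum (l.map A).prod := by
  induction l with
  | nil => exact one hG
  | cons i l ih =>
    rw [List.map_cons, List.map_cons, List.sum_cons, List.prod_cons]
    exact (hA i).mul hG ih

lemma shiftPow {c : AdmissibleSeq} (hG : ∀ δ, G δ ≠ 0)
    (hS : ∀ j, RaisesDepth T G (Pi.single j 1) (shift T c j)) (α : Fin d → ℕ) :
    RaisesDepth T G α (shiftPow T c α) := by
  have hsum : ((List.finRange d).map fun j => α j • (Pi.single j 1 : Fin d → ℕ)).sum = α := by
    rw [← List.ofFn_eq_map, List.sum_ofFn]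
    simp_rw [← Pi.single_smul, smul_eq_mul, mul_one]
    exact Finset.univ_sum_single α
  have h := list_prod hG (fun j => (hS j).pow hG (α j)) (List.finRange d)
  rwa [hsum, ← List.ofFn_eq_map] at h

lemma norm_sum_sq (hA : RaisesDepth T G β A) (s : Finset (Fin d → ℕ))
    {f : (Fin d → ℕ) → ℓ²(∀ j, V j, ℂ)} (hf : ∀ δ, f δ ∈ depthSpace T δ) :
    ‖A (∑ δ ∈ s, f δ)‖ ^ 2 = ∑ δ ∈ s, G (δ + β) / G δ * ‖f δ‖ ^ 2 := by
  have horth := (orthogonalFamily_depthSpace T).comp (add_left_injective β)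
  calc ‖A (∑ δ ∈ s, f δ)‖ ^ 2
      = ∑ δ ∈ s, ‖A (f δ)‖ ^ 2 := by
        rw [map_sum]
        exact horth.norm_sum (fun δ => ⟨A (f δ), (hA δ _ (hf δ)).1⟩) s
    _ = ∑ δ ∈ s, G (δ + β) / G δ * ‖f δ‖ ^ 2 :=
        Finset.sum_congr rfl fun δ _ => (hA δ _ (hf δ)).2

end RaisesDepth

/-! ### The depth components of the joint kernel -/

lemma mem_jointKernel_iff {c : AdmissibleSeq} {f : ℓ²(∀ j, V j, ℂ)} :
    f ∈ jointKernel T c ↔ ∀ j g, ⟪shift T c j g, f⟫_ℂ = 0 := by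
  simp only [jointKernel, Submodule.mem_iInf, LinearMap.mem_ker, ContinuousLinearMap.coe_coe,
    ← ContinuousLinearMap.adjoint_inner_right]
  refine forall_congr' fun j => ⟨fun h g => ?_, fun h => ?_⟩
  · rw [h, inner_zero_right]
  · exact inner_self_eq_zero.1 (h _)

variable (T) in
/-- The orthogonal projection onto `depthSpace T δ`. -/
def depthProj (δ : Fin d → ℕ) : ℓ²(∀ j, V j, ℂ) →L[ℂ] ℓ²(∀ j, V j, ℂ) :=
  l2Indicator {v | depth T v = δ}

lemma depthProj_apply_of_eq {δ : Fin d → ℕ} (f : ℓ²(∀ j, V j, ℂ)) {v : ∀ j, V j}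
    (hv : depth T v = δ) : depthProj T δ f v = f v :=
  indicator_of_mem (s := {v | depth T v = δ}) hv f

lemma depthProj_mem_depthSpace (δ : Fin d → ℕ) (f : ℓ²(∀ j, V j, ℂ)) :
    depthProj T δ f ∈ depthSpace T δ :=
  fun _ hv => indicator_of_notMem (s := {v | depth T v = δ}) hv f

lemma depthProj_shift (c : AdmissibleSeq) (j : Fin d) (δ : Fin d → ℕ) (f : ℓ²(∀ j, V j, ℂ)) :
    depthProj T δ (shift T c j f) =
      shift T c j (l2Indicator {u | depth T u + Pi.single j 1 = δ} f) := by
  classical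
  refine lp.ext (funext fun v => ?_)
  rw [depthProj, coe_l2Indicator, indicator_apply]
  by_cases hroot : v j = (T j).root
  · simp only [shift_apply_of_eq_root c _ hroot, ite_self]
  · simp only [shift_apply_of_ne_root c _ hroot, coe_l2Indicator, indicator_apply, mem_ofPred_eq,
      depth_eq_depth_par_add_single hroot, mul_ite, mul_zero]

lemma depthProj_mem_jointKernel {c : AdmissibleSeq} (δ : Fin d → ℕ) {f : ℓ²(∀ j, V j, ℂ)}
    (hf : f ∈ jointKernel T c) : depthProj T δ f ∈ jointKernel T c := by
  rw [mem_jointKernel_iff] at hf ⊢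
  intro j g
  rw [depthProj, ← inner_l2Indicator_left, ← depthProj, depthProj_shift, hf]

lemma shift_single_par (c : AdmissibleSeq) {j : Fin d} {v : ∀ j, V j}
    [DecidableEq (∀ j, V j)] (hroot : v j ≠ (T j).root)
    (honly : (T j).children (par T j v j) = {v j}) :
    shift T c j (lp.single 2 (par T j v) 1) = lp.single 2 v (weight T c j v : ℂ) := by
  refine lp.ext (funext fun w => ?_)
  by_cases hw : w j = (T j).root
  · have hwv : w ≠ v := fun h => hroot (h ▸ hw)
    simp [shift_apply_of_eq_root c _ hw, lp.single_apply, hwv]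
  have hiff : par T j w = par T j v ↔ w = v := by
    refine ⟨fun h => ?_, congrArg _⟩
    have hmem := mem_children_par hw
    rw [h, honly, mem_singleton_iff] at hmem
    rw [← update_par (T := T) j w, h, hmem, update_par]
  rw [shift_apply_of_ne_root c _ hw, lp.single_apply, lp.single_apply, Pi.single_apply,
    Pi.single_apply]
  by_cases hwv : w = v <;> simp [hiff, hwv]

variable (T) in
/-- The multi-index of the branching indices (with `0` in place of `⊤`). Elements of the joint
kernel vanish at the vertices whose depth is not bounded by it. -/
def branchingIndices (j : Fin d) : ℕ := (T j).branchingIndex.toNat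

lemma eq_zero_of_mem_jointKernel (hbranch : ∀ j, (T j).branchingIndex ≠ ⊤) {c : AdmissibleSeq}
    {f : ℓ²(∀ j, V j, ℂ)} (hf : f ∈ jointKernel T c) {v : ∀ j, V j}
    (hv : ¬ depth T v ≤ branchingIndices T) : f v = 0 := by
  classical
  obtain ⟨j, hj⟩ : ∃ j, branchingIndices T j < depth T v j := by simpa [Pi.le_def] using hv
  have hroot : v j ≠ (T j).root := fun h => by simp [depth, h, (T j).depth_root] at hj
  have honly : (T j).children (par T j v j) = {v j} := by
    simpa [par] using RootedDirectedTree.children_parent_eq_singleton (hbranch j) hj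
  have hinner := mem_jointKernel_iff.1 hf j (lp.single 2 (par T j v) 1)
  rw [shift_single_par c hroot honly, lp.inner_single_left] at hinner
  have hweight : (weight T c j v : ℂ) ≠ 0 := by
    exact_mod_cast weight_ne_zero c (by simp [honly])
  simpa [hweight] using hinner

variable (T) in
/-- The orthogonal projection of the joint kernel onto its elements supported in depth `δ`. -/
def kernelProj (c : AdmissibleSeq) (δ : Fin d → ℕ) : jointKernel T c →L[ℂ] jointKernel T c :=
  (depthProj T δ).restrict fun _ hf => depthProj_mem_jointKernel δ hf

lemma inner_kernelProj_self (c : AdmissibleSeq) (δ : Fin d → ℕ) (f : jointKernel T c) :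
    ⟪f, kernelProj T c δ f⟫_ℂ = ((‖kernelProj T c δ f‖ ^ 2 : ℝ) : ℂ) :=
  inner_l2Indicator_self _ (f : ℓ²(∀ j, V j, ℂ))

lemma kernelProj_eq_zero (c : AdmissibleSeq) {δ ε : Fin d → ℕ} (h : δ ≠ ε) {f : jointKernel T c}
    (hf : (f : ℓ²(∀ j, V j, ℂ)) ∈ depthSpace T ε) : kernelProj T c δ f = 0 := by
  refine Subtype.ext (lp.ext (funext fun v => ?_))
  change depthProj T δ f v = 0
  by_cases hv : depth T v = δ
  · rw [depthProj_apply_of_eq _ hv, hf v (hv ▸ h)]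
  · exact depthProj_mem_depthSpace δ _ v hv

lemma sum_kernelProj (hbranch : ∀ j, (T j).branchingIndex ≠ ⊤) (c : AdmissibleSeq)
    (f : jointKernel T c) : ∑ δ ∈ Finset.Iic (branchingIndices T), kernelProj T c δ f = f := by
  refine Subtype.ext (lp.ext (funext fun v => ?_))
  rw [Submodule.coe_sum, lp.coeFn_sum, Finset.sum_apply]
  have hne (δ : Fin d → ℕ) (h : δ ≠ depth T v) : depthProj T δ f v = 0 :=
    depthProj_mem_depthSpace δ _ v h.symm
  calc ∑ δ ∈ Finset.Iic (branchingIndices T), depthProj T δ f v = depthProj T (depth T v) f v :=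
        Finset.sum_eq_single _ (fun δ _ h => hne δ h) fun h => by
          rw [depthProj_apply_of_eq _ rfl,
            eq_zero_of_mem_jointKernel hbranch f.2 (by simpa using h)]
    _ = f.1 v := depthProj_apply_of_eq _ rfl

lemma norm_shiftPow_sq {c : AdmissibleSeq} (hbranch : ∀ j, (T j).branchingIndex ≠ ⊤)
    {G : (Fin d → ℕ) → ℝ} {α : Fin d → ℕ} (hS : RaisesDepth T G α (shiftPow T c α))
    (f : jointKernel T c) :
    ‖shiftPow T c α f‖ ^ 2 =
      ∑ δ ∈ Finset.Iic (branchingIndices T), G (δ + α) / G δ * ‖kernelProj T c δ f‖ ^ 2 := by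
  have hf : (f : ℓ²(∀ j, V j, ℂ)) = ∑ δ ∈ Finset.Iic (branchingIndices T), depthProj T δ f := by
    conv_lhs => rw [← sum_kernelProj hbranch c f, Submodule.coe_sum]
    rfl
  rw [hf]
  exact hS.norm_sum_sq _ fun δ => depthProj_mem_depthSpace δ _

end TreeProduct

/-! ### Uniqueness of power series expansions -/

lemma eq_zero_of_hasSum_pow_mul {r : ℝ} (hr : 0 < r) {a : ℕ → ℂ}
    (h : ∀ t : ℂ, ‖t‖ < r → HasSum (fun n => t ^ n * a n) 0) : a = 0 := by
  have hseries : HasFPowerSeriesOnBall (0 : ℂ → ℂ)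
      (fun n => ContinuousMultilinearMap.mkPiRing ℂ (Fin n) (a n)) 0 (ENNReal.ofReal r) := by
    refine ⟨?_, ENNReal.ofReal_pos.2 hr, fun {y} hy => ?_⟩
    · refine ENNReal.le_of_forall_nnreal_lt fun q hq => ?_
      have hqr : ‖((q : ℝ) : ℂ)‖ < r := by
        rw [Complex.norm_real, NNReal.norm_eq]
        exact (ENNReal.lt_ofReal_iff_toReal_lt ENNReal.coe_ne_top).1 hq
      refine FormalMultilinearSeries.le_radius_of_tendsto _ (l := 0) ?_
      have := (h _ hqr).summable.tendsto_atTop_zero.norm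
      simpa [mul_comm] using this
    · rw [Metric.mem_eball, edist_zero_right, ← ofReal_norm,
        ENNReal.ofReal_lt_ofReal_iff hr] at hy
      simpa using h y hy
  have hzero := hseries.hasFPowerSeriesAt.eq_zero
  funext n
  have := congrArg (fun p : FormalMultilinearSeries ℂ ℂ ℂ => p n fun _ => 1) hzero
  simpa using this

namespace TreeProduct

variable {d : ℕ}

lemma monom_smul (t : ℂ) (z : EuclideanSpace ℂ (Fin d)) (β : Fin d → ℕ) :
    monom (t • z) β = t ^ (∑ j, β j) * monom z β := by
  simp only [monom, PiLp.smul_apply, smul_eq_mul, mul_pow, Finset.prod_mul_distrib,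
    Finset.prod_pow_eq_pow_sum]

lemma hasSum_pow_mul_homogeneous {a : (Fin d → ℕ) → ℂ} {t s : ℂ} {z : EuclideanSpace ℂ (Fin d)}
    (h : HasSum (fun β => monom (t • z) β * a β) s) :
    HasSum (fun n => t ^ n * ∑ β ∈ Finset.piAntidiag Finset.univ n, monom z β * a β) s := by
  refine ((Equiv.sigmaFiberEquiv fun β : Fin d → ℕ => ∑ j, β j).hasSum_iff.2 h).sigma fun n => ?_
  have hmem (β : Fin d → ℕ) : β ∈ Finset.piAntidiag Finset.univ n ↔ ∑ j, β j = n := by simp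
  have hfiber : HasSum (fun β : {β : Fin d → ℕ // ∑ j, β j = n} => monom (t • z) β.1 * a β.1)
      (∑ β ∈ Finset.piAntidiag Finset.univ n, monom (t • z) β * a β) :=
    (Equiv.subtypeEquivRight hmem).hasSum_iff.1 (Finset.hasSum _ _)
  convert! hfiber using 1
  rw [Finset.mul_sum]
  refine Finset.sum_congr rfl fun β hβ => ?_
  rw [monom_smul, (hmem β).1 hβ, mul_assoc]

lemma eq_zero_of_sum_monom_mul_eq_zero {s : Finset (Fin d → ℕ)} {a : (Fin d → ℕ) → ℂ} {r : ℝ}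
    (hr : 0 < r) (h : ∀ z ∈ Metric.ball 0 r, ∑ β ∈ s, monom z β * a β = 0) {β : Fin d → ℕ}
    (hβ : β ∈ s) : a β = 0 := by
  let toMonomial (β : Fin d → ℕ) : Fin d →₀ ℕ := Finsupp.equivFunOnFinite.symm β
  have hbox : WithLp.toLp 2 ⁻¹' Metric.ball (0 : EuclideanSpace ℂ (Fin d)) r ∈
      nhds (0 : Fin d → ℂ) :=
    (PiLp.continuous_toLp 2 _).continuousAt.preimage_mem_nhds (Metric.ball_mem_nhds _ hr)
  obtain ⟨ε, hε, hεU⟩ := Metric.mem_nhds_iff.1 hbox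
  have hpoly : ∑ β ∈ s, MvPolynomial.monomial (toMonomial β) (a β) = 0 := by
    refine MvPolynomial.funext_set (fun _ => Metric.ball 0 ε)
      (fun _ => infinite_of_mem_nhds 0 (Metric.ball_mem_nhds _ hε)) fun x hx => ?_
    rw [ball_pi _ hε] at hεU
    rw [map_sum, map_zero, ← h _ (hεU hx)]
    refine Finset.sum_congr rfl fun β _ => ?_
    rw [MvPolynomial.eval_monomial, mul_comm, monom, Finsupp.prod_fintype _ _ (by simp)]
    rfl
  have hcoeff := congrArg (MvPolynomial.coeff (toMonomial β)) hpoly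
  simpa [MvPolynomial.coeff_sum, MvPolynomial.coeff_monomial, toMonomial, hβ] using hcoeff

lemma eq_zero_of_hasSum_monom_mul {r : ℝ} (hr : 0 < r) {a : (Fin d → ℕ) → ℂ}
    (h : ∀ z ∈ Metric.ball (0 : EuclideanSpace ℂ (Fin d)) r,
      HasSum (fun β => monom z β * a β) 0) : a = 0 := by
  have hhom (n : ℕ) (z : EuclideanSpace ℂ (Fin d)) (hz : z ∈ Metric.ball 0 r) :
      ∑ β ∈ Finset.piAntidiag Finset.univ n, monom z β * a β = 0 := by
    have hseries : (fun n => ∑ β ∈ Finset.piAntidiag Finset.univ n, monom z β * a β) = 0 := by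
      refine eq_zero_of_hasSum_pow_mul one_pos fun t ht => ?_
      refine hasSum_pow_mul_homogeneous (h (t • z) ?_)
      rw [mem_ball_zero_iff] at hz ⊢
      rw [norm_smul]
      exact (mul_le_of_le_one_left (norm_nonneg z) ht.le).trans_lt hz
    exact congrFun hseries n
  funext β
  exact eq_zero_of_sum_monom_mul_eq_zero hr (hhom (∑ j, β j)) (by simp)

variable {V : Fin d → Type*} {T : ∀ j, RootedDirectedTree (V j)}

lemma IsCoeff.unique {c : AdmissibleSeq} {r : ℝ} (hr : 0 < r)
    {G : Metric.ball (0 : EuclideanSpace ℂ (Fin d)) r → jointKernel T c}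
    {f g : (Fin d → ℕ) → jointKernel T c} (hf : IsCoeff T c G f) (hg : IsCoeff T c G g) :
    f = g := by
  have hinner (e : jointKernel T c) : (fun β => ⟪e, f β - g β⟫_ℂ) = 0 := by
    refine eq_zero_of_hasSum_monom_mul hr fun z hz => ?_
    have := ((hf.2 ⟨z, hz⟩).sub (hg.2 ⟨z, hz⟩)).mapL (innerSL ℂ e)
    simpa [← smul_sub, inner_smul_right, inner_sub_right] using this
  funext β
  exact sub_eq_zero.1 (inner_self_eq_zero (𝕜 := ℂ).1 (congrFun (hinner (f β - g β)) β))

lemma coeff_monomial [DecidableEq (Fin d → ℕ)] (c : AdmissibleSeq) {r : ℝ} (hr : 0 < r)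
    (α : Fin d → ℕ) (f : jointKernel T c) : coeff T (monomial T c r α f) = Pi.single α f := by
  refine IsCoeff.unique hr (monomial T c r α f).2.choose_spec ⟨?_, fun z => ?_⟩
  · refine summable_of_ne_finset_zero (s := {α}) fun β hβ => ?_
    rw [Finset.mem_singleton] at hβ
    simp [Pi.single_eq_of_ne hβ]
  · have := hasSum_single (f := fun β => monom z.1 β • (Pi.single α f : _ → jointKernel T c) β) α
      fun β hβ => by simp [Pi.single_eq_of_ne hβ]
    simpa [monomial] using this

lemma modelNorm_monomial_sq (c : AdmissibleSeq) {r : ℝ} (hr : 0 < r) (α : Fin d → ℕ)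
    (f : jointKernel T c) : modelNorm T (monomial T c r α f) ^ 2 = ‖shiftPow T c α f‖ ^ 2 := by
  classical
  have h : modelInner T (monomial T c r α f) (monomial T c r α f) =
      ⟪shiftPow T c α f, shiftPow T c α f⟫_ℂ := by
    rw [modelInner, coeff_monomial c hr, tsum_eq_single α]
    · rw [Pi.single_eq_same]
    · intro β hβ
      simp [Pi.single_eq_of_ne hβ]
  rw [modelNorm, h, Real.sq_sqrt inner_self_nonneg, inner_self_eq_norm_sq]

end TreeProduct

/-! ### Monomial moments of the sphere -/

section Polar

variable {E : Type*} [NormedAddCommGroup E] [NormedSpace ℝ E] [FiniteDimensional ℝ E]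
  [Nontrivial E] [MeasurableSpace E] [BorelSpace E]

lemma integral_volumeIoiPow (n : ℕ) (g : ℝ → ℝ) :
    ∫ r : Ioi (0 : ℝ), g r ∂(.volumeIoiPow n) = ∫ r in Ioi (0 : ℝ), r ^ n * g r := by
  simp only [Measure.volumeIoiPow, ENNReal.ofReal]
  rw [integral_withDensity_eq_integral_smul (measurable_subtype_coe.pow_const _).real_toNNReal,
    integral_subtype_comap measurableSet_Ioi fun r : ℝ => Real.toNNReal (r ^ n) • g r]
  refine setIntegral_congr_fun measurableSet_Ioi fun r (hr : 0 < r) => ?_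
  rw [NNReal.smul_def, Real.coe_toNNReal _ (pow_nonneg hr.le _), smul_eq_mul]

lemma integral_homogeneous_mul_fun_norm (μ : Measure E) [μ.IsAddHaarMeasure] {f : E → ℝ} {n : ℕ}
    (hf : ∀ r : ℝ, 0 < r → ∀ x, f (r • x) = r ^ n * f x) (g : ℝ → ℝ) :
    ∫ x, f x * g ‖x‖ ∂μ = (∫ ζ, f ζ.1 ∂μ.toSphere) *
      ∫ r in Ioi (0 : ℝ), r ^ (Module.finrank ℝ E - 1) * (r ^ n * g r) := by
  have hpolar (p : Metric.sphere (0 : E) 1 × Ioi (0 : ℝ)) :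
      f (p.2.1 • p.1.1) * g ‖p.2.1 • p.1.1‖ = f p.1.1 * (p.2.1 ^ n * g p.2.1) := by
    have hnorm : ‖p.2.1 • p.1.1‖ = p.2.1 := by
      rw [norm_smul, norm_eq_of_mem_sphere, mul_one, Real.norm_of_nonneg (le_of_lt p.2.2)]
    rw [hnorm, hf _ p.2.2]
    ring
  calc ∫ x, f x * g ‖x‖ ∂μ
    _ = ∫ x : ({0}ᶜ : Set E), f x * g ‖x.1‖ ∂(μ.comap (↑)) := by
        rw [integral_subtype_comap (measurableSet_singleton _).compl fun x => f x * g ‖x‖,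
          restrict_compl_singleton]
    _ = ∫ p : Metric.sphere (0 : E) 1 × Ioi (0 : ℝ), f (p.2.1 • p.1.1) * g ‖p.2.1 • p.1.1‖
          ∂(μ.toSphere.prod (.volumeIoiPow (Module.finrank ℝ E - 1))) := by
        rw [← μ.measurePreserving_homeomorphUnitSphereProd.integral_comp
          (Homeomorph.measurableEmbedding _)]
        refine integral_congr_ae (.of_forall fun x => ?_)
        have h := homeomorphUnitSphereProd_symm_apply_coe E (homeomorphUnitSphereProd E x)
        rw [Homeomorph.symm_apply_apply] at h
        exact congrArg (fun x => f x * g ‖x‖) h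
    _ = ∫ p : Metric.sphere (0 : E) 1 × Ioi (0 : ℝ), f p.1.1 * (p.2.1 ^ n * g p.2.1)
          ∂(μ.toSphere.prod (.volumeIoiPow (Module.finrank ℝ E - 1))) := by
        simp_rw [hpolar]
    _ = _ := by
        rw [integral_prod_mul (fun ζ : Metric.sphere (0 : E) 1 => f ζ.1)
          (fun r : Ioi (0 : ℝ) => r.1 ^ n * g r.1),
          integral_volumeIoiPow _ fun r => r ^ n * g r]

end Polar

lemma integral_Ioi_pow_mul_gaussian (n : ℕ) :
    ∫ r in Ioi (0 : ℝ), r ^ (2 * n + 1) * Real.exp (-r ^ 2) = n.factorial / 2 := by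
  have h := integral_rpow_mul_exp_neg_rpow (p := 2) (q := (2 * n + 1 : ℕ)) two_pos
    (neg_one_lt_zero.trans_le (Nat.cast_nonneg _))
  simp only [Real.rpow_natCast, Real.rpow_two] at h
  rw [h, show (((2 * n + 1 : ℕ) : ℝ) + 1) / 2 = n + 1 by push_cast; ring,
    Real.Gamma_nat_eq_factorial]
  ring

lemma integral_complex_pow_mul_gaussian (k : ℕ) :
    ∫ z : ℂ, ‖z‖ ^ (2 * k) * Real.exp (-‖z‖ ^ 2) = Real.pi * k.factorial := by
  have h := Complex.integral_rpow_mul_exp_neg_rpow (p := 2) (q := (2 * k : ℕ)) one_le_two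
    ((neg_lt_zero.2 two_pos).trans_le (Nat.cast_nonneg _))
  simp only [Real.rpow_natCast, Real.rpow_two] at h
  rw [h, show (((2 * k : ℕ) : ℝ) + 2) / 2 = k + 1 by push_cast; ring, Real.Gamma_nat_eq_factorial]
  ring

lemma finrank_real_euclideanSpace_complex (ι : Type*) [Fintype ι] :
    Module.finrank ℝ (EuclideanSpace ℂ ι) = 2 * Fintype.card ι := by
  rw [← Module.finrank_mul_finrank ℝ ℂ, Complex.finrank_real_complex, finrank_euclideanSpace]

lemma measurePreserving_equiv_euclideanSpace_complex (ι : Type*) [Fintype ι] :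
    MeasurePreserving (EuclideanSpace.equiv ι ℂ) := by
  set e := EuclideanSpace.equiv ι ℂ
  have : (volume.map e).IsAddHaarMeasure := e.isAddHaarMeasure_map _
  have hscalar : volume.map e = (volume.map e).addHaarScalarFactor volume • volume :=
    Measure.isAddLeftInvariant_eq_smul _ _
  refine ⟨e.continuous.measurable, ?_⟩
  have hprod : ∫ y : ι → ℂ, ∏ j, Real.exp (-‖y j‖ ^ 2) = Real.pi ^ Fintype.card ι := by
    rw [integral_fintype_prod_volume_eq_prod fun (_ : ι) (y : ℂ) => Real.exp (-‖y‖ ^ 2)]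
    have h := integral_complex_pow_mul_gaussian 0
    simp only [mul_zero, pow_zero, one_mul, Nat.factorial_zero, Nat.cast_one, mul_one] at h
    rw [h, Finset.prod_const, Finset.card_univ]
  have hmap : ∫ y, ∏ j, Real.exp (-‖y j‖ ^ 2) ∂volume.map e = Real.pi ^ Fintype.card ι := by
    rw [integral_map e.continuous.aemeasurable (Continuous.aestronglyMeasurable (by fun_prop))]
    have h := GaussianFourier.integral_rexp_neg_mul_sq_norm (V := EuclideanSpace ℂ ι) one_pos
    rw [finrank_real_euclideanSpace_complex] at h
    convert! h using 1
    · simp [← Real.exp_sum, EuclideanSpace.norm_sq_eq, e]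
    · simp
  rw [hscalar, integral_smul_nnreal_measure, hprod, NNReal.smul_def, smul_eq_mul] at hmap
  have hone := (mul_eq_right₀ (by positivity)).1 hmap
  rw [hscalar, NNReal.coe_eq_one.1 hone, one_smul]

namespace TreeProduct

variable {d : ℕ}

lemma monom_add (z : EuclideanSpace ℂ (Fin d)) (α β : Fin d → ℕ) :
    monom z (α + β) = monom z α * monom z β := by
  simp only [monom, Pi.add_apply, pow_add, Finset.prod_mul_distrib]

lemma monom_zero (z : EuclideanSpace ℂ (Fin d)) : monom z 0 = 1 := by
  simp [monom]

@[fun_prop]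
lemma continuous_monom (β : Fin d → ℕ) :
    Continuous fun z : EuclideanSpace ℂ (Fin d) => monom z β := by
  unfold monom
  fun_prop

lemma norm_monom_sq (z : EuclideanSpace ℂ (Fin d)) (β : Fin d → ℕ) :
    ‖monom z β‖ ^ 2 = ∏ j, ‖z j‖ ^ (2 * β j) := by
  simp only [monom, norm_prod, norm_pow, ← Finset.prod_pow, ← pow_mul, mul_comm]

lemma norm_monom_smul_sq {r : ℝ} (hr : 0 < r) (z : EuclideanSpace ℂ (Fin d)) (β : Fin d → ℕ) :
    ‖monom (r • z) β‖ ^ 2 = r ^ (2 * ∑ j, β j) * ‖monom z β‖ ^ 2 := by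
  rw [← Complex.coe_smul r z, monom_smul, norm_mul, norm_pow, Complex.norm_real,
    Real.norm_of_nonneg hr.le, mul_pow, ← pow_mul, mul_comm 2]

lemma integral_norm_monom_sq_mul_gaussian (β : Fin d → ℕ) :
    ∫ z : EuclideanSpace ℂ (Fin d), ‖monom z β‖ ^ 2 * Real.exp (-‖z‖ ^ 2) =
      Real.pi ^ d * ∏ j, ((β j).factorial : ℝ) := by
  have hsplit (z : EuclideanSpace ℂ (Fin d)) : ‖monom z β‖ ^ 2 * Real.exp (-‖z‖ ^ 2) =
      ∏ j, (‖z j‖ ^ (2 * β j) * Real.exp (-‖z j‖ ^ 2)) := by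
    rw [Finset.prod_mul_distrib, ← Real.exp_sum, Finset.sum_neg_distrib, norm_monom_sq,
      EuclideanSpace.norm_sq_eq]
  have hequiv := (measurePreserving_equiv_euclideanSpace_complex (Fin d)).integral_comp
    (EuclideanSpace.equiv (Fin d) ℂ).toHomeomorph.measurableEmbedding
    fun y => ∏ j, (‖y j‖ ^ (2 * β j) * Real.exp (-‖y j‖ ^ 2))
  simp_rw [hsplit]
  refine hequiv.trans ?_
  rw [integral_fintype_prod_volume_eq_prod
      (fun j (y : ℂ) => ‖y‖ ^ (2 * β j) * Real.exp (-‖y‖ ^ 2))]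
  simp only [integral_complex_pow_mul_gaussian, Finset.prod_mul_distrib, Finset.prod_const,
    Finset.card_univ, Fintype.card_fin]

variable [NeZero d]

instance isProbabilityMeasure_sphereMeasure : IsProbabilityMeasure (sphereMeasure d) := by
  constructor
  rw [sphereMeasure, Measure.smul_apply, smul_eq_mul]
  refine ENNReal.inv_mul_cancel ?_ (measure_ne_top _ _)
  rw [Ne, Measure.measure_univ_eq_zero]
  exact Measure.toSphere_ne_zero _

lemma integral_toSphere_norm_monom_sq (β : Fin d → ℕ) :
    ∫ ζ : Sphere d, ‖monom ζ.1 β‖ ^ 2 ∂(volume : Measure (EuclideanSpace ℂ (Fin d))).toSphere =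
      2 * Real.pi ^ d * ((∏ j, ((β j).factorial : ℝ)) / ((∑ j, β j) + d - 1).factorial) := by
  have hpolar := integral_homogeneous_mul_fun_norm volume (f := fun z => ‖monom z β‖ ^ 2)
    (fun r hr z => norm_monom_smul_sq hr z β) fun r => Real.exp (-r ^ 2)
  have hexp : 2 * d - 1 + 2 * ∑ j, β j = 2 * (∑ j, β j + d - 1) + 1 := by
    have := NeZero.pos d
    omega
  simp_rw [← mul_assoc, ← pow_add] at hpolar
  rw [integral_norm_monom_sq_mul_gaussian, finrank_real_euclideanSpace_complex, Fintype.card_fin,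
    hexp, integral_Ioi_pow_mul_gaussian] at hpolar
  field_simp at hpolar ⊢
  linarith

lemma integral_sphereMeasure_norm_monom_sq (β : Fin d → ℕ) :
    ∫ ζ, ‖monom ζ.1 β‖ ^ 2 ∂sphereMeasure d =
      (d - 1).factorial * (∏ j, ((β j).factorial : ℝ)) / ((∑ j, β j) + d - 1).factorial := by
  have harea := integral_toSphere_norm_monom_sq (d := d) 0
  simp only [monom_zero, norm_one, one_pow, integral_const, smul_eq_mul, mul_one, Pi.zero_apply,
    Nat.factorial_zero, Nat.cast_one, Finset.prod_const_one, Finset.sum_const_zero, zero_add,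
    measureReal_def] at harea
  rw [sphereMeasure, integral_smul_measure, integral_toSphere_norm_monom_sq, ENNReal.toReal_inv,
    harea, smul_eq_mul]
  field_simp

lemma integral_sphereMeasure_norm_monom_sq_pos (β : Fin d → ℕ) :
    0 < ∫ ζ, ‖monom ζ.1 β‖ ^ 2 ∂sphereMeasure d := by
  rw [integral_sphereMeasure_norm_monom_sq]
  positivity

lemma integral_sphereMeasure_norm_monom_add_single_sq (β : Fin d → ℕ) (j : Fin d) :
    ∫ ζ, ‖monom ζ.1 (β + Pi.single j 1)‖ ^ 2 ∂sphereMeasure d =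
      (β j + 1) / ((∑ i, β i : ℕ) + d) * ∫ ζ, ‖monom ζ.1 β‖ ^ 2 ∂sphereMeasure d := by
  have hsum : ∑ i, (β + Pi.single j 1 : Fin d → ℕ) i + d - 1 = (∑ i, β i + d - 1) + 1 := by
    have := NeZero.pos d
    simp only [Pi.add_apply, Finset.sum_add_distrib, Finset.sum_pi_single', Finset.mem_univ,
      if_true]
    omega
  have hprod : ∏ i, (((β + Pi.single j 1 : Fin d → ℕ) i).factorial : ℝ) =
      (β j + 1) * ∏ i, ((β i).factorial : ℝ) := by
    rw [← Finset.mul_prod_erase _ _ (Finset.mem_univ j),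
      ← Finset.mul_prod_erase _ (fun i => ((β i).factorial : ℝ)) (Finset.mem_univ j), ← mul_assoc]
    congr 1
    · simp [Nat.factorial_succ]
    · refine Finset.prod_congr rfl fun i hi => ?_
      simp [Pi.single_eq_of_ne (Finset.ne_of_mem_erase hi)]
  have hcast : ((∑ i, β i + d - 1 : ℕ) : ℝ) + 1 = (∑ i, β i : ℕ) + d := by
    have := NeZero.pos d
    exact_mod_cast (by omega : ∑ i, β i + d - 1 + 1 = ∑ i, β i + d)
  have := NeZero.pos d
  rw [integral_sphereMeasure_norm_monom_sq, integral_sphereMeasure_norm_monom_sq, hsum, hprod,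
    Nat.factorial_succ, Nat.cast_mul, Nat.cast_add_one, hcast]
  field_simp

end TreeProduct

section SumSMulMeasure

variable {X ι F : Type*} [MeasurableSpace X] [NormedAddCommGroup F] [NormedSpace ℝ F]

/-- The vector measure `A ↦ ∑ i ∈ s, m i A • v i` built from scalar measures `m i` and vectors
`v i`. -/
def sumSMulMeasure (s : Finset ι) (m : ι → Measure X) [∀ i, IsFiniteMeasure (m i)] (v : ι → F) :
    VectorMeasure X F :=
  ∑ i ∈ s, (m i).toSignedMeasure.mapRange
    (ContinuousLinearMap.toSpanSingleton ℝ (v i)).toLinearMap.toAddMonoidHom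
    (ContinuousLinearMap.toSpanSingleton ℝ (v i)).continuous

lemma sumSMulMeasure_apply (s : Finset ι) (m : ι → Measure X) [∀ i, IsFiniteMeasure (m i)]
    (v : ι → F) {A : Set X} (hA : MeasurableSet A) :
    sumSMulMeasure s m v A = ∑ i ∈ s, (m i).real A • v i := by
  rw [sumSMulMeasure, ← FunLike.coeAddMonoidHom_apply, map_sum, Finset.sum_apply]
  refine Finset.sum_congr rfl fun i _ => ?_
  rw [← Measure.toSignedMeasure_apply_measurable hA]
  rfl

end SumSMulMeasure

lemma integrable_pow_of_compl_Icc {b : ℝ} {μ : Measure ℝ} [IsFiniteMeasure μ]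
    (hμ : μ (Icc 0 b)ᶜ = 0) (n : ℕ) : Integrable (fun s => s ^ n) μ := by
  refine Integrable.of_bound (by fun_prop) (b ^ n) ?_
  filter_upwards [measure_eq_zero_iff_ae_notMem.1 hμ] with s hs
  rw [notMem_compl_iff] at hs
  rw [norm_pow, Real.norm_of_nonneg hs.1]
  exact pow_le_pow_left₀ hs.1 hs.2 n

namespace TreeProduct

variable {d : ℕ} {V : Fin d → Type*} {T : ∀ j, RootedDirectedTree (V j)}

/-! ### Product measures with prescribed monomial moments -/

lemma integrable_norm_monom_sq (μ : Measure (Sphere d)) [IsFiniteMeasure μ] (β : Fin d → ℕ) :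
    Integrable (fun z : Sphere d => ‖monom z.1 β‖ ^ 2) μ :=
  Continuous.integrable_of_hasCompactSupport (by fun_prop) (HasCompactSupport.of_compactSpace _)

/-- The measure `|z^δ|² / ‖z^δ‖² dσ` on the unit sphere. -/
def monomMeasure (δ : Fin d → ℕ) : Measure (Sphere d) :=
  (sphereMeasure d).withDensity fun z =>
    ENNReal.ofReal (‖monom z.1 δ‖ ^ 2 / ∫ ζ, ‖monom ζ.1 δ‖ ^ 2 ∂sphereMeasure d)

lemma integral_norm_monom_sq_monomMeasure (δ α : Fin d → ℕ) :
    ∫ z, ‖monom z.1 α‖ ^ 2 ∂monomMeasure δ =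
      (∫ ζ, ‖monom ζ.1 (δ + α)‖ ^ 2 ∂sphereMeasure d) /
        ∫ ζ, ‖monom ζ.1 δ‖ ^ 2 ∂sphereMeasure d := by
  simp only [monomMeasure, ENNReal.ofReal]
  rw [integral_withDensity_eq_integral_smul (by fun_prop), ← integral_div]
  refine integral_congr_ae (.of_forall fun z => ?_)
  simp only [NNReal.smul_def, smul_eq_mul]
  rw [Real.coe_toNNReal _ (by positivity), monom_add, norm_mul]
  ring

/-- The squared norm of `z^δ` in the model space of `c` on the ball of `ℂ^d`, that is, in the
classical case where every tree is a single infinite path. -/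
def monomNormSq (c : AdmissibleSeq) (δ : Fin d → ℕ) : ℝ :=
  (∏ t ∈ Finset.range (∑ j, δ j), c.toFun t) * ∫ ζ, ‖monom ζ.1 δ‖ ^ 2 ∂sphereMeasure d

lemma monomNormSq_add_div (c : AdmissibleSeq) (δ α : Fin d → ℕ) :
    monomNormSq c (δ + α) / monomNormSq c δ =
      (∏ k ∈ Finset.range (∑ j, α j), c.toFun (∑ j, δ j + k)) *
        ((∫ ζ, ‖monom ζ.1 (δ + α)‖ ^ 2 ∂sphereMeasure d) /
          ∫ ζ, ‖monom ζ.1 δ‖ ^ 2 ∂sphereMeasure d) := by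
  have hprod : ∏ t ∈ Finset.range (∑ j, δ j), c.toFun t ≠ 0 :=
    Finset.prod_ne_zero_iff.2 fun t _ => (c.toFun_pos t).ne'
  rw [monomNormSq, monomNormSq]
  simp only [Pi.add_apply, Finset.sum_add_distrib]
  rw [Finset.prod_range_add, mul_assoc, mul_div_mul_left _ _ hprod, mul_div_assoc]

variable [NeZero d]

instance isFiniteMeasure_monomMeasure (δ : Fin d → ℕ) : IsFiniteMeasure (monomMeasure δ) :=
  isFiniteMeasure_withDensity_ofReal
    ((integrable_norm_monom_sq _ δ).div_const _).hasFiniteIntegral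

instance isProbabilityMeasure_monomMeasure_zero :
    IsProbabilityMeasure (monomMeasure (0 : Fin d → ℕ)) := by
  simp only [monomMeasure, monom_zero, norm_one, one_pow, integral_const, probReal_univ,
    smul_eq_mul, mul_one, div_one, ENNReal.ofReal_one, withDensity_const, one_smul]
  infer_instance

lemma monomNormSq_ne_zero (c : AdmissibleSeq) (δ : Fin d → ℕ) : monomNormSq c δ ≠ 0 :=
  mul_ne_zero (Finset.prod_ne_zero_iff.2 fun t _ => (c.toFun_pos t).ne')
    (integral_sphereMeasure_norm_monom_sq_pos δ).ne'

lemma raisesDepth_shift (hfin : ∀ j, (T j).LocallyFinite) (hleaf : ∀ j, (T j).Leafless)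
    (c : AdmissibleSeq) (j : Fin d) :
    RaisesDepth T (monomNormSq c) (Pi.single j 1) (shift T c j) := by
  refine fun δ f hf => ⟨shift_mem_depthSpace c j hf, ?_⟩
  have hpos := (integral_sphereMeasure_norm_monom_sq_pos δ).ne'
  rw [norm_shift_sq_of_mem_depthSpace hfin hleaf c j hf, monomNormSq_add_div,
    integral_sphereMeasure_norm_monom_add_single_sq, mul_div_cancel_right₀ _ hpos,
    Finset.sum_pi_single' j, if_pos (Finset.mem_univ j), Finset.prod_range_one, add_zero]

lemma norm_shiftPow_sq_eq_sum_monomNormSq (hfin : ∀ j, (T j).LocallyFinite)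
    (hleaf : ∀ j, (T j).Leafless) (hbranch : ∀ j, (T j).branchingIndex ≠ ⊤) (c : AdmissibleSeq)
    (α : Fin d → ℕ) (f : jointKernel T c) :
    ‖shiftPow T c α f‖ ^ 2 = ∑ δ ∈ Finset.Iic (branchingIndices T),
      monomNormSq c (δ + α) / monomNormSq c δ * ‖kernelProj T c δ f‖ ^ 2 :=
  norm_shiftPow_sq hbranch
    (.shiftPow (monomNormSq_ne_zero c) (raisesDepth_shift hfin hleaf c) α) f

/-- The product measure `ρ_u × ν_u` shared by the vertices `u` of depth `δ`, for radial measures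
`ρ` that depend on `|δ|` only. -/
def depthMeasure (ρ : ℕ → Measure ℝ) (δ : Fin d → ℕ) : Measure (ℝ × Sphere d) :=
  (ρ (∑ j, δ j)).prod (monomMeasure δ)

section DepthMeasure

variable {b : ℝ} {c : AdmissibleSeq} {ρ : ℕ → Measure ℝ}

lemma depthMeasure_eq_zero (hρ : ∀ l, ρ l (Icc 0 b)ᶜ = 0) (δ : Fin d → ℕ)
    {A : Set (ℝ × Sphere d)} (hA : Disjoint A (Icc 0 b ×ˢ univ)) : depthMeasure ρ δ A = 0 := by
  refine measure_mono_null (t := (Icc 0 b)ᶜ ×ˢ univ) (fun p hp => ?_) ?_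
  · exact ⟨fun h => disjoint_left.1 hA hp ⟨h, mem_univ _⟩, mem_univ _⟩
  · rw [depthMeasure, Measure.prod_prod, hρ, zero_mul]

variable [∀ l, IsFiniteMeasure (ρ l)]

instance isFiniteMeasure_depthMeasure (δ : Fin d → ℕ) : IsFiniteMeasure (depthMeasure ρ δ) := by
  unfold depthMeasure
  infer_instance

lemma integrable_depthMeasure (hρ : ∀ l, ρ l (Icc 0 b)ᶜ = 0) (δ α : Fin d → ℕ) :
    Integrable (fun p : ℝ × Sphere d => p.1 ^ (∑ j, α j) * ‖monom p.2.1 α‖ ^ 2)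
      (depthMeasure ρ δ) :=
  (integrable_pow_of_compl_Icc (hρ _) _).mul_prod (integrable_norm_monom_sq _ α)

lemma integral_depthMeasure
    (hmoment : ∀ l n, ∫ s, s ^ n ∂ρ l = ∏ k ∈ Finset.range n, c.toFun (l + k))
    (δ α : Fin d → ℕ) :
    ∫ p : ℝ × Sphere d, p.1 ^ (∑ j, α j) * ‖monom p.2.1 α‖ ^ 2 ∂depthMeasure ρ δ =
      monomNormSq c (δ + α) / monomNormSq c δ := by
  rw [depthMeasure, integral_prod_mul (fun s : ℝ => s ^ (∑ j, α j))
    fun z : Sphere d => ‖monom z.1 α‖ ^ 2, hmoment, integral_norm_monom_sq_monomMeasure,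
    monomNormSq_add_div]

end DepthMeasure

/-! ### Representing measures from solutions of the radial moment problem -/

variable (T) in
/-- The operator valued measure `A ↦ ∑_δ (ρ_δ × ν_δ)(A) P_δ`, where `P_δ` is the projection of `E`
onto its depth `δ` component. -/
def kernelMeasure (c : AdmissibleSeq) (ρ : ℕ → Measure ℝ) [∀ l, IsFiniteMeasure (ρ l)] :
    VectorMeasure (ℝ × Sphere d) (jointKernel T c →L[ℂ] jointKernel T c) :=
  sumSMulMeasure (Finset.Iic (branchingIndices T)) (depthMeasure ρ) (kernelProj T c)

/-- The positive measure `⟨M(·) f, f⟩`, for `M` the `kernelMeasure`. -/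
def kernelScalarMeasure {c : AdmissibleSeq} (ρ : ℕ → Measure ℝ) (f : jointKernel T c) :
    Measure (ℝ × Sphere d) :=
  ∑ δ ∈ Finset.Iic (branchingIndices T), ‖kernelProj T c δ f‖₊ ^ 2 • depthMeasure ρ δ

section KernelMeasure

variable {b r : ℝ} {c : AdmissibleSeq} {ρ : ℕ → Measure ℝ} [∀ l, IsFiniteMeasure (ρ l)]

lemma kernelMeasure_apply {A : Set (ℝ × Sphere d)} (hA : MeasurableSet A) (f : jointKernel T c) :
    kernelMeasure T c ρ A f = ∑ δ ∈ Finset.Iic (branchingIndices T),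
      (((depthMeasure ρ δ).real A : ℝ) : ℂ) • kernelProj T c δ f := by
  rw [kernelMeasure, sumSMulMeasure_apply _ _ _ hA, sum_apply]
  rfl

lemma kernelMeasure_eq_zero (hρ : ∀ l, ρ l (Icc 0 b)ᶜ = 0) {A : Set (ℝ × Sphere d)}
    (hA : MeasurableSet A) (hdisj : Disjoint A (Icc 0 b ×ˢ univ)) :
    kernelMeasure T c ρ A = 0 := by
  refine ContinuousLinearMap.ext fun f => ?_
  rw [kernelMeasure_apply hA]
  refine Finset.sum_eq_zero fun δ _ => ?_
  rw [measureReal_def, depthMeasure_eq_zero hρ δ hdisj, ENNReal.toReal_zero, Complex.ofReal_zero,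
    zero_smul]

instance isFiniteMeasure_kernelScalarMeasure (f : jointKernel T c) :
    IsFiniteMeasure (kernelScalarMeasure ρ f) := by
  unfold kernelScalarMeasure
  infer_instance

lemma inner_kernelMeasure {A : Set (ℝ × Sphere d)} (hA : MeasurableSet A) (f : jointKernel T c) :
    ⟪f, kernelMeasure T c ρ A f⟫_ℂ = ((kernelScalarMeasure ρ f).real A : ℂ) := by
  rw [kernelMeasure_apply hA, inner_sum, kernelScalarMeasure, measureReal_def,
    Measure.finsetSum_apply, ENNReal.toReal_sum fun δ _ => measure_ne_top _ _, Complex.ofReal_sum]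
  refine Finset.sum_congr rfl fun δ _ => ?_
  refine (inner_smul_right f (kernelProj T c δ f) (((depthMeasure ρ δ).real A : ℝ) : ℂ)).trans ?_
  rw [inner_kernelProj_self, mul_comm, ← measureReal_def, measureReal_nnreal_smul_apply]
  push_cast
  rfl

lemma integrable_kernelScalarMeasure (hρ : ∀ l, ρ l (Icc 0 b)ᶜ = 0) (f : jointKernel T c)
    (α : Fin d → ℕ) :
    Integrable (fun p : ℝ × Sphere d => p.1 ^ (∑ j, α j) * ‖monom p.2.1 α‖ ^ 2)
      (kernelScalarMeasure ρ f) :=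
  integrable_finsetSum_measure.2 fun δ _ =>
    (integrable_depthMeasure hρ δ α).smul_measure_nnreal

lemma modelNorm_monomial_sq_eq_integral (hfin : ∀ j, (T j).LocallyFinite)
    (hleaf : ∀ j, (T j).Leafless) (hbranch : ∀ j, (T j).branchingIndex ≠ ⊤) (hr : 0 < r)
    (hρ : ∀ l, ρ l (Icc 0 b)ᶜ = 0)
    (hmoment : ∀ l n, ∫ s, s ^ n ∂ρ l = ∏ k ∈ Finset.range n, c.toFun (l + k))
    (f : jointKernel T c) (α : Fin d → ℕ) :
    modelNorm T (monomial T c r α f) ^ 2 =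
      ∫ p, p.1 ^ (∑ j, α j) * ‖monom p.2.1 α‖ ^ 2 ∂kernelScalarMeasure ρ f := by
  rw [modelNorm_monomial_sq c hr, norm_shiftPow_sq_eq_sum_monomNormSq hfin hleaf hbranch,
    kernelScalarMeasure, integral_finsetSum_measure fun δ _ =>
      (integrable_depthMeasure hρ δ α).smul_measure_nnreal]
  refine Finset.sum_congr rfl fun δ _ => ?_
  rw [integral_smul_nnreal_measure, integral_depthMeasure hmoment, mul_comm]
  rfl

lemma kernelMeasure_apply_of_mem_depthSpace (hbranch : ∀ j, (T j).branchingIndex ≠ ⊤)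
    {A : Set (ℝ × Sphere d)} (hA : MeasurableSet A) {δ : Fin d → ℕ} {f : jointKernel T c}
    (hf : (f : ℓ²(∀ j, V j, ℂ)) ∈ depthSpace T δ) :
    kernelMeasure T c ρ A f = (((depthMeasure ρ δ).real A : ℝ) : ℂ) • f := by
  conv_rhs => rw [← sum_kernelProj hbranch c f, Finset.smul_sum]
  rw [kernelMeasure_apply hA]
  refine Finset.sum_congr rfl fun ε _ => ?_
  obtain rfl | hne := eq_or_ne ε δ
  · rfl
  · rw [kernelProj_eq_zero c hne hf, smul_zero, smul_zero]

theorem isRepresentingMeasure_kernelMeasure (hfin : ∀ j, (T j).LocallyFinite)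
    (hleaf : ∀ j, (T j).Leafless) (hbranch : ∀ j, (T j).branchingIndex ≠ ⊤) (hr : 0 < r)
    (hρ : ∀ l, ρ l (Icc 0 b)ᶜ = 0)
    (hmoment : ∀ l n, ∫ s, s ^ n ∂ρ l = ∏ k ∈ Finset.range n, c.toFun (l + k))
    {Ω : Finset (Fin d) → Set (∀ j, V j)} (hΩ : ∀ F, Ω F ⊆ Phi T F) :
    IsRepresentingMeasure T c r b Ω (kernelMeasure T c ρ) (fun u => ρ (absDepth T u))
      (fun u => monomMeasure (depth T u)) where
  finite F u _ := ⟨inferInstance, inferInstance⟩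
  supported_scalar F u _ := hρ _
  supported A hA hdisj := kernelMeasure_eq_zero hρ hA hdisj
  integral_representation f :=
    ⟨kernelScalarMeasure ρ f, inferInstance, fun A hA => inner_kernelMeasure hA f, fun α =>
      ⟨integrable_kernelScalarMeasure hρ f α,
        modelNorm_monomial_sq_eq_integral hfin hleaf hbranch hr hρ hmoment f α⟩⟩
  diagonal A hA I hI g hg := by
    rw [map_sum]
    exact Finset.sum_congr rfl fun p hp => kernelMeasure_apply_of_mem_depthSpace hbranch hA
      (mem_depthSpace_of_mem_cokerPiece (hΩ p.1 (hI p hp)) (hg p hp))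
  normalized := by
    have hprob : IsProbabilityMeasure (ρ 0) :=
      isProbabilityMeasure_iff_real.2 (by simpa using hmoment 0 0)
    rw [absDepth, depth_root]
    exact ⟨by simpa using hprob, inferInstance⟩

end KernelMeasure

end TreeProduct

/-! ### The radial measures -/

lemma prod_range_natCast_add {m : ℕ} (hm : 0 < m) (n : ℕ) :
    ∏ k ∈ Finset.range n, ((m : ℝ) + k) = (m + n - 1).factorial / (m - 1).factorial := by
  rw [eq_div_iff (by positivity), mul_comm]
  exact_mod_cast (Nat.ascFactorial_eq_prod_range m n ▸ Nat.factorial_mul_ascFactorial' m n hm)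

lemma prod_range_sub_natCast (n : ℕ) :
    ∏ k ∈ Finset.range n, ((k : ℝ) - n) = (-1) ^ n * n.factorial := by
  have hneg : ∀ k ∈ Finset.range n, ((n - 1 - k : ℕ) : ℝ) - n = -1 * (k + 1 : ℕ) := by
    intro k hk
    have : n - 1 - k + (k + 1) = n := by
      have := Finset.mem_range.1 hk
      omega
    rw [neg_one_mul, sub_eq_iff_eq_add, eq_neg_add_iff_add_eq, add_comm]
    exact_mod_cast this
  rw [← Finset.prod_range_reflect, Finset.prod_congr rfl hneg, Finset.prod_mul_distrib,
    Finset.prod_const, Finset.card_range, ← Finset.prod_range_add_one_eq_factorial, Nat.cast_prod]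

lemma prod_range_erase_sub_natCast {m n : ℕ} (hmn : m ≤ n) :
    ∏ k ∈ (Finset.range (n + 1)).erase m, ((k : ℝ) - m) =
      (-1) ^ m * (m.factorial * (n - m).factorial) := by
  have hsplit : (Finset.range (n + 1)).erase m = Finset.range m ∪ Finset.Ico (m + 1) (n + 1) := by
    grind
  have hdisj : Disjoint (Finset.range m) (Finset.Ico (m + 1) (n + 1)) := by
    grind [Finset.disjoint_left]
  have hupper : ∏ k ∈ Finset.Ico (m + 1) (n + 1), ((k : ℝ) - m) = (n - m).factorial := by
    rw [Finset.prod_Ico_eq_prod_range, Nat.add_sub_add_right,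
      ← Finset.prod_range_add_one_eq_factorial, Nat.cast_prod]
    refine Finset.prod_congr rfl fun k _ => ?_
    push_cast
    ring
  rw [hsplit, Finset.prod_union hdisj, prod_range_sub_natCast, hupper, mul_assoc]

lemma sum_pow_div_prod_range_erase (n : ℕ) (s : ℝ) :
    ∑ m ∈ Finset.range (n + 1), s ^ m / ∏ k ∈ (Finset.range (n + 1)).erase m, ((k : ℝ) - m) =
      (1 - s) ^ n / n.factorial := by
  rw [sub_eq_neg_add, add_pow, Finset.sum_div]
  refine Finset.sum_congr rfl fun m hm => ?_
  have hmn : m ≤ n := Nat.lt_succ_iff.1 (Finset.mem_range.1 hm)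
  rw [prod_range_erase_sub_natCast hmn, Nat.cast_choose ℝ hmn, one_pow, neg_pow s]
  have hsign : ((-1 : ℝ) ^ m)⁻¹ = (-1) ^ m := by rw [← inv_pow, inv_neg_one]
  rw [div_mul_eq_div_div, div_eq_mul_inv (s ^ m), hsign]
  field_simp

lemma integral_pow_mul_one_sub_pow (p q : ℕ) :
    ∫ s in (0 : ℝ)..1, s ^ p * (1 - s) ^ q =
      (p.factorial : ℝ) * q.factorial / (p + q + 1).factorial := by
  have hbeta := ProbabilityTheory.beta_eq_betaIntegralReal (p + 1) (q + 1) (by positivity)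
    (by positivity)
  have hreal : Complex.betaIntegral ((p + 1 : ℝ) : ℂ) ((q + 1 : ℝ) : ℂ) =
      ((∫ s in (0 : ℝ)..1, s ^ p * (1 - s) ^ q : ℝ) : ℂ) := by
    rw [Complex.betaIntegral, ← intervalIntegral.integral_ofReal]
    refine intervalIntegral.integral_congr fun s _ => ?_
    simp
  rw [hreal, Complex.ofReal_re, ProbabilityTheory.beta] at hbeta
  rw [← hbeta, Real.Gamma_nat_eq_factorial, Real.Gamma_nat_eq_factorial,
    ← Real.Gamma_nat_eq_factorial (p + q + 1)]
  push_cast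
  ring_nf

namespace TreeProduct

lemma radialWeight_eq {d a : ℕ} (hd : 0 < d) (h : d < a) (l : ℕ) (s : ℝ) :
    radialWeight d a l s = (l + a - 1).factorial / (l + d - 1).factorial *
      (s ^ (l + d - 1) * (1 - s) ^ (a - d - 1) / (a - d - 1).factorial) := by
  obtain ⟨n, rfl⟩ := Nat.exists_eq_add_of_lt h
  have hcoeff : ∏ k ∈ Finset.Ico d (d + n + 1), ((l : ℝ) + k) =
      (l + (d + n + 1) - 1).factorial / (l + d - 1).factorial := by
    rw [Finset.prod_Ico_eq_prod_range, add_assoc d n 1, Nat.add_sub_cancel_left, ← add_assoc l,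
      ← prod_range_natCast_add (by omega)]
    push_cast
    simp only [add_assoc]
  have hsum : ∑ i ∈ Finset.Ico d (d + n + 1),
      s ^ (i + l - 1) / ∏ j ∈ (Finset.Ico d (d + n + 1)).erase i, ((j : ℝ) - i) =
      s ^ (l + d - 1) * ((1 - s) ^ n / n.factorial) := by
    have hshift : Finset.Ico d (d + n + 1) = (Finset.range (n + 1)).map (addLeftEmbedding d) := by
      rw [Finset.range_eq_Ico, Finset.map_add_left_Ico, add_zero, add_assoc]
    rw [hshift, Finset.sum_map, ← sum_pow_div_prod_range_erase, Finset.mul_sum]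
    refine Finset.sum_congr rfl fun m _ => ?_
    rw [← Finset.map_erase, Finset.prod_map, ← mul_div_assoc, ← pow_add]
    congr 2
    · simp only [addLeftEmbedding_apply]
      omega
    · simp
  rw [radialWeight, hcoeff, hsum, add_assoc d n 1, Nat.add_sub_cancel_left, Nat.add_sub_cancel,
    mul_div_assoc]

lemma radialWeight_nonneg {d a : ℕ} (hd : 0 < d) (h : d < a) (l : ℕ) {s : ℝ}
    (hs : s ∈ Icc (0 : ℝ) 1) : 0 ≤ radialWeight d a l s := by
  rw [radialWeight_eq hd h]
  have := hs.1
  have : 0 ≤ 1 - s := sub_nonneg.2 hs.2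
  positivity

lemma continuous_radialWeight (d a l : ℕ) : Continuous (radialWeight d a l) := by
  unfold radialWeight
  fun_prop

lemma integral_pow_mul_radialWeight {d a : ℕ} (hd : 0 < d) (h : d < a) (l n : ℕ) :
    ∫ s in (0 : ℝ)..1, s ^ n * radialWeight d a l s =
      ∏ k ∈ Finset.range n, (((l + k : ℕ) : ℝ) + d) / ((l + k : ℕ) + a) := by
  have hsplit (s : ℝ) : s ^ n * radialWeight d a l s =
      (l + a - 1).factorial / (l + d - 1).factorial / (a - d - 1).factorial *
        (s ^ (l + d + n - 1) * (1 - s) ^ (a - d - 1)) := by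
    rw [radialWeight_eq hd h, show l + d + n - 1 = l + d - 1 + n by omega, pow_add]
    ring
  have hprod (b : ℕ) (hb : 0 < b) : ∏ k ∈ Finset.range n, (((l + k : ℕ) : ℝ) + b) =
      (l + b + n - 1).factorial / (l + b - 1).factorial := by
    rw [← prod_range_natCast_add (by omega)]
    push_cast
    simp only [add_right_comm]
  simp_rw [hsplit]
  rw [intervalIntegral.integral_const_mul, integral_pow_mul_one_sub_pow, Finset.prod_div_distrib,
    hprod d hd, hprod a (hd.trans h),
    show l + d + n - 1 + (a - d - 1) + 1 = l + a + n - 1 by omega]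
  field_simp

/-- The measure `ρ` attached to the vertices of total depth `l`: it has density
`radialWeight d a l` on `[0, 1]` if `d < a`, and is the unit point mass at `1` otherwise. -/
def radialMeasure (d a l : ℕ) : Measure ℝ :=
  if d < a then (volume.restrict (Icc (0 : ℝ) 1)).withDensity fun s =>
    ENNReal.ofReal (radialWeight d a l s)
  else Measure.dirac 1

instance isFiniteMeasure_radialMeasure (d a l : ℕ) : IsFiniteMeasure (radialMeasure d a l) := by
  unfold radialMeasure
  split_ifs
  · refine isFiniteMeasure_withDensity_ofReal (Integrable.hasFiniteIntegral ?_)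
    exact (continuous_radialWeight d a l).integrableOn_Icc
  · infer_instance

lemma radialMeasure_compl_Icc (d a l : ℕ) : radialMeasure d a l (Icc 0 1)ᶜ = 0 := by
  unfold radialMeasure
  split_ifs
  · refine withDensity_absolutelyContinuous _ _ ?_
    rw [Measure.restrict_apply measurableSet_Icc.compl, compl_inter_self, measure_empty]
  · simp

lemma integral_pow_radialMeasure {d a : ℕ} (hd : 0 < d) (ha : 0 < a) (had : d ≤ a) (l n : ℕ) :
    ∫ s, s ^ n ∂radialMeasure d a l =
      ∏ k ∈ Finset.range n, (druryArvesonSeq d a hd (Nat.cast_pos.2 ha)).toFun (l + k) := by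
  unfold radialMeasure
  split_ifs with h
  · refine Eq.trans ?_ (integral_pow_mul_radialWeight hd h l n)
    simp only [ENNReal.ofReal]
    rw [integral_withDensity_eq_integral_smul
      (continuous_radialWeight d a l).measurable.real_toNNReal,
      intervalIntegral.integral_of_le zero_le_one, ← integral_Icc_eq_integral_Ioc]
    refine setIntegral_congr_fun measurableSet_Icc fun s hs => ?_
    rw [NNReal.smul_def, Real.coe_toNNReal _ (radialWeight_nonneg hd h l hs), smul_eq_mul, mul_comm]
  · obtain rfl : a = d := by omega
    rw [integral_dirac, one_pow, Finset.prod_eq_one]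
    intro k _
    exact div_self (by positivity)

end TreeProduct

end

theorem corollary2p10 {d : ℕ} (hd : 0 < d) {V : Fin d → Type*}
    (T : ∀ j, RootedDirectedTree (V j))
    (hfin : ∀ j, (T j).LocallyFinite) (hleaf : ∀ j, (T j).Leafless)
    (hbranch : ∀ j, (T j).branchingIndex ≠ ⊤)
    (a : ℕ) (ha : 0 < a) (had : d ≤ a)
    (Ω : Finset (Fin d) → Set (∀ j, V j)) (hΩ : TreeProduct.IsIndexing T Ω) :
    (d < a → ∀ l : ℕ, ∀ s ∈ Set.Icc (0 : ℝ) 1, 0 ≤ TreeProduct.radialWeight d a l s) ∧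
    ∃ (M : VectorMeasure (ℝ × TreeProduct.Sphere d)
          (TreeProduct.jointKernel T (druryArvesonSeq d a hd (Nat.cast_pos.2 ha)) →L[ℂ]
            TreeProduct.jointKernel T (druryArvesonSeq d a hd (Nat.cast_pos.2 ha))))
      (ρ : (∀ j, V j) → Measure ℝ) (ν : (∀ j, V j) → Measure (TreeProduct.Sphere d)),
      TreeProduct.IsRepresentingMeasure T (druryArvesonSeq d a hd (Nat.cast_pos.2 ha)) 1 1 Ω M ρ ν ∧
      ∀ F, ∀ u ∈ Ω F,
        (d < a → ρ u = (volume.restrict (Set.Icc (0 : ℝ) 1)).withDensity fun s =>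
          ENNReal.ofReal (TreeProduct.radialWeight d a (TreeProduct.absDepth T u) s)) ∧
        (a = d → ρ u = Measure.dirac 1) ∧
        ν u = (TreeProduct.sphereMeasure d).withDensity fun z =>
          ENNReal.ofReal (‖TreeProduct.monom z.1 (TreeProduct.depth T u)‖ ^ 2 /
            ∫ ζ, ‖TreeProduct.monom ζ.1 (TreeProduct.depth T u)‖ ^ 2
              ∂TreeProduct.sphereMeasure d) := by
  have : NeZero d := ⟨hd.ne'⟩
  refine ⟨fun h l s hs => TreeProduct.radialWeight_nonneg hd h l hs, _, _, _,
    TreeProduct.isRepresentingMeasure_kernelMeasure hfin hleaf hbranch one_pos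
      (TreeProduct.radialMeasure_compl_Icc d a)
      (TreeProduct.integral_pow_radialMeasure hd ha had) fun F => (hΩ F).1,
    fun F u _ => ⟨fun h => if_pos h, fun h => if_neg h.le.not_gt, rfl⟩⟩
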